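/- **Setting.** For a simplicial pair $(K,K_0)$ (a simplicial complex and a subcomplex), $|K-K_0|$ is the union of the open simplices of $K$ not in $K_0$. Let $M$ be a topological $m$-manifold without boundary (Hausdorff, locally Euclidean), triangulated by a simplicial pair $(K,K_0)$ through a homeomorphism $\phi:|K-K_0|\to M$; let $K^1,K^2$ be the first and second (barycentric) subdivisions of $K$. The open star $\mathrm{st}\,\sigma$ of a simplex $\sigma$ is the union of the open simplices having $\sigma$ as a face. For a triangulated space, a *basic open set associated to* $\sigma$ is an open set $U\subseteq\mathrm{st}\,\sigma$ that contains a point of the open simplex $\sigma$ about which it is star-shaped in barycentric coordinates; these sets include the open stars and form a basis of the topology. A *bisheaf* around $M$ is a sheaf $\overline F$ and a cosheaf $\underline F$ of abelian groups on $M$ with homomorphisms $F(U):\overline F(U)\to\underline F(U)$ for all non-empty connected open $U$, such that $\underline F(V\subseteq U)\circ F(V)\circ\overline F(V\subseteq U)=F(U)$ whenever $V\subseteq U$. It is *$K$-constructible* if $\overline F(V\subseteq U)$ and $\underline F(V\subseteq U)$ are isomorphisms whenever $V\subseteq U$ are basic open sets associated to the same simplex. An *episheaf* is a constructible sheaf whose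 restriction maps between basic open sets are surjective; a *monocosheaf* is a constructible cosheaf whose extension maps between basic open sets are injective. $\mathrm{Epi}(\overline F)$ is the largest sub-episheaf of $\overline F$, $\mathrm{Mono}(\underline F)$ is the smallest quotient of $\underline F$ that is a monocosheaf (the quotient by the smallest possible kernel), and $\mathrm{Iso}(F)$ is the bisheaf given by the compositions $\mathrm{Epi}(\overline F)\hookrightarrow\overline F\to\underline F\twoheadrightarrow\mathrm{Mono}(\underline F)$. On basic open sets $U$, the images of these compositions form a local system (all maps induced by inclusions $V\subseteq U$ are isomorphisms), the *persistent local system* $\mathrm{im}\,\mathrm{Iso}(F)$. An *étale open* is a local homeomorphism $a:A\to M$ from a Hausdorff space $A$; sheaves, cosheaves and stratifications are pulled back along it, so $(a^*F)(U)=F(a(U))$ for an open $U$ on which $a$ is injective and whose image is basic. It is *$K$-constructible* if there are a simplicial pair $(L,L_0)$, a homeomorphism $\chi:|L-L_0|\to A$ and a simplicial map $\psi:L\to K$ with $a\circ\chi=\phi\circ|\psi|$, such that every simplex of $L_0$ is a face of a simplex of $L-L_0$, and every $(m-1)$-simplex of $L_0$ is a face of exactly one $m$-simplex of $L-L_0$.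 The *shrinking* of $a$ (for such data) is the restriction $\dot a$ of $a$ to the open subset $\dot A=|L^2-\mathrm{cl}\,\mathrm{st}\,L_0^2|$ of $A$, where $\mathrm{cl}\,\mathrm{st}\,L_0^2$ consists of all faces of those simplices of $L^2$ that have a face in $L_0^2$; let $\mu:\dot A\to A$ be the inclusion. The *dilation* $\Sigma:K^2\to K^1$ is the simplicial map that sends the vertex $[\sigma_0\subsetneq\dots\subsetneq\sigma_n]$ of $K^2$ to the vertex $\sigma_0$ of $K^1$. For a $K$-constructible bisheaf $F$, $\Sigma^*F$ is the $K^2$-constructible bisheaf, on the part of $M$ that $|\Sigma|$ maps into $|K-K_0|$ (an open set containing $\dot a(\dot A)$, and all of $M$ if $K_0=\emptyset$), with $(\Sigma^*F)(U)=F(\mathrm{st}\,\Sigma(\tau))$ for a basic open set $U$ of $K^2$ associated to the simplex $\tau$ of $K^2$, for sheaf, cosheaf and map alike. **Proposition.** Let $F$ be a $K$-constructible bisheaf around $M$ and $a:A\to M$ a $K$-constructible étale open with shrinking $\dot a:\dot A\to M$ and inclusion $\mu:\dot A\to A$. Then the persistent local systems $\mathrm{im}\,\mu^*\mathrm{Iso}(a^*F)$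 (with $\mathrm{Iso}$ formed for the stratification of $A$ pulled back from $K$) and $\mathrm{im}\,\mathrm{Iso}(\dot a^*\Sigma^*F)$ (with $\mathrm{Iso}$ formed for the stratification of $\dot A$ pulled back from $K^2$) are isomorphic as local systems over $\dot A$. -/

import Mathlib

open CategoryTheory Opposite TopologicalSpace
universe u u' v v' w
namespace PersistentSheaf

section Simplicial
variable {V : Type v}

/-- The open simplex on the vertices `s`, in barycentric coordinates. -/
def openSimplex (s : Finset V) : Set (V → ℝ) :=
  {x | (∀ v ∈ s, 0 < x v) ∧ (∀ v ∉ s, x v = 0) ∧ ∑ v ∈ s, x v = 1}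

/-- The first subdivision of a simplicial complex: its simplices are the non-empty chains of
simplices. -/
def sd (K : PreAbstractSimplicialComplex V) : PreAbstractSimplicialComplex (Finset V) where
  faces := {c | c.Nonempty ∧ (∀ σ ∈ c, σ ∈ K) ∧ IsChain (· ⊆ ·) (c : Set (Finset V))}
  isRelLowerSet_faces := by
    rintro c ⟨h1, h2, h3⟩
    exact ⟨h1, fun d hd hne => ⟨hne, fun σ hσ => h2 σ (hd hσ), h3.mono (Finset.coe_subset.2 hd)⟩⟩

/-- The affine map `|sd K| → |K|` that sends the vertex `σ` to the barycenter of `σ`. -/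
noncomputable def sdMap (f : Finset V → ℝ) : V → ℝ :=
  fun v => ∑ᶠ (σ : Finset V) (_ : v ∈ σ), f σ / (σ.card : ℝ)

/-- The open simplex `c` of the first subdivision, as a subset of `|K|`. -/
def cell₁ (c : Finset (Finset V)) : Set (V → ℝ) := sdMap '' openSimplex c

/-- The open simplex `C` of the second subdivision, as a subset of `|K|`. -/
def cell₂ (C : Finset (Finset (Finset V))) : Set (V → ℝ) := sdMap '' (sdMap '' openSimplex C)

/-- The closed star `cl st J₀` of a subcomplex `J₀` in `J`: all faces of simplices that have a
face in `J₀`. -/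
def closedStar (J J₀ : PreAbstractSimplicialComplex V) : Set (Finset V) :=
  {s | s ∈ J ∧ ∃ t ∈ J, s ⊆ t ∧ ∃ r ∈ J₀, r ⊆ t}

open Classical in
/-- The dilation on vertices: a non-empty chain `σ₀ ⊊ ⋯ ⊊ σₙ` is sent to its least member `σ₀`. -/
noncomputable def dilationVertex (c : Finset (Finset V)) : Finset V :=
  if h : c.Nonempty then c.inf' h id else ∅

open Classical in
/-- The dilation `Σ`, a simplicial map from the second to the first subdivision. -/
noncomputable def dilation (C : Finset (Finset (Finset V))) : Finset (Finset V) :=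
  C.image dilationVertex

theorem mem_nonempty {K : PreAbstractSimplicialComplex V} {s : Finset V} (h : s ∈ K) :
    s.Nonempty := (K.isRelLowerSet_faces h).1

open Classical in
theorem dilationVertex_mem {c : Finset (Finset V)} (hne : c.Nonempty)
    (hc : IsChain (· ⊆ ·) (c : Set (Finset V))) :
    dilationVertex c ∈ c ∧ ∀ σ ∈ c, dilationVertex c ⊆ σ := by
  have hle : ∀ σ ∈ c, dilationVertex c ⊆ σ := by
    intro σ hσ
    rw [dilationVertex, dif_pos hne]
    exact Finset.inf'_le id hσ
  refine ⟨?_, hle⟩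
  rw [dilationVertex, dif_pos hne]
  refine Finset.inf'_mem (c : Set (Finset V)) ?_ c hne id (fun i hi => hi)
  intro x hx y hy
  rcases hc.total hx hy with h | h
  · rwa [inf_eq_left.2 h]
  · rwa [inf_eq_right.2 h]

theorem dilation_mem {K : PreAbstractSimplicialComplex V} {C : Finset (Finset (Finset V))}
    (hC : C ∈ sd (sd K)) : dilation C ∈ sd K := by
  classical
  obtain ⟨hne, hsub, hch⟩ := hC
  refine ⟨hne.image _, ?_, ?_⟩
  · intro σ hσ
    obtain ⟨c, hc, rfl⟩ := Finset.mem_image.1 hσ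
    obtain ⟨h1, h2, h3⟩ := hsub c hc
    exact h2 _ (dilationVertex_mem h1 h3).1
  · intro σ hσ τ hτ _
    obtain ⟨c, hc, rfl⟩ := Finset.mem_image.1 (Finset.mem_coe.1 hσ)
    obtain ⟨d, hd, rfl⟩ := Finset.mem_image.1 (Finset.mem_coe.1 hτ)
    obtain ⟨c1, -, c3⟩ := hsub c hc
    obtain ⟨d1, -, d3⟩ := hsub d hd
    rcases hch.total hc hd with h | h
    · exact Or.inr ((dilationVertex_mem d1 d3).2 _ (h (dilationVertex_mem c1 c3).1))
    · exact Or.inl ((dilationVertex_mem c1 c3).2 _ (h (dilationVertex_mem d1 d3).1))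

open Classical in
theorem sdMap_apply {c : Finset (Finset V)} {f : Finset V → ℝ} (hf : ∀ σ ∉ c, f σ = 0) (v : V) :
    sdMap f v = ∑ σ ∈ c, if v ∈ σ then f σ / (σ.card : ℝ) else 0 := by
  rw [sdMap]
  have h : ∀ σ : Finset V, (∑ᶠ (_ : v ∈ σ), f σ / (σ.card : ℝ)) =
      if v ∈ σ then f σ / (σ.card : ℝ) else 0 := fun σ => finsum_eq_if
  simp_rw [h]
  refine finsum_eq_sum_of_support_subset _ fun σ hσ => ?_
  by_contra hc
  apply hσ
  simp [hf σ hc]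

theorem exists_top {K : PreAbstractSimplicialComplex V} {c : Finset (Finset V)} (hc : c ∈ sd K) :
    ∃ σ ∈ c, ∀ τ ∈ c, τ ⊆ σ := by
  classical
  refine ⟨c.sup' hc.1 id, ?_, fun τ hτ => Finset.le_sup' id hτ⟩
  refine Finset.sup'_mem (c : Set (Finset V)) ?_ c hc.1 id (fun i hi => hi)
  intro x hx y hy
  rcases hc.2.2.total hx hy with h | h
  · rwa [sup_eq_right.2 h]
  · rwa [sup_eq_left.2 h]

theorem sdMap_mem_openSimplex {K : PreAbstractSimplicialComplex V} {c : Finset (Finset V)}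
    (hc : c ∈ sd K) {σ : Finset V} (hσ : σ ∈ c) (htop : ∀ τ ∈ c, τ ⊆ σ) {f : Finset V → ℝ}
    (hf : f ∈ openSimplex c) : sdMap f ∈ openSimplex σ := by
  classical
  obtain ⟨hpos, hzero, hsum⟩ := hf
  have hcard : ∀ τ ∈ c, 0 < (τ.card : ℝ) := fun τ hτ => by
    exact_mod_cast Finset.card_pos.2 (mem_nonempty (hc.2.1 τ hτ))
  refine ⟨fun v hv => ?_, fun v hv => ?_, ?_⟩
  · rw [sdMap_apply hzero]
    refine Finset.sum_pos' (fun τ hτ => ?_) ⟨σ, hσ, ?_⟩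
    · split_ifs
      · exact (div_pos (hpos τ hτ) (hcard τ hτ)).le
      · exact le_rfl
    · rw [if_pos hv]
      exact div_pos (hpos σ hσ) (hcard σ hσ)
  · rw [sdMap_apply hzero]
    exact Finset.sum_eq_zero fun τ hτ => if_neg fun h => hv (htop τ hτ h)
  · simp_rw [sdMap_apply hzero]
    rw [Finset.sum_comm, ← hsum]
    refine Finset.sum_congr rfl fun τ hτ => ?_
    rw [← Finset.sum_filter, Finset.sum_const, Finset.filter_mem_eq_inter,
      Finset.inter_eq_right.2 (htop τ hτ), nsmul_eq_mul, mul_div_cancel₀ _ (hcard τ hτ).ne']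

theorem lt_of_mem_cell₁ {K : PreAbstractSimplicialComplex V} {c : Finset (Finset V)}
    (hc : c ∈ sd K) {x : V → ℝ} (hx : x ∈ cell₁ c) {σ : Finset V} (hσ : σ ∈ c) {v w : V}
    (hv : v ∈ σ) (hw : w ∉ σ) : x w < x v := by
  classical
  obtain ⟨f, ⟨hpos, hzero, -⟩, rfl⟩ := hx
  have hcard : ∀ τ ∈ c, 0 < (τ.card : ℝ) := fun τ hτ => by
    exact_mod_cast Finset.card_pos.2 (mem_nonempty (hc.2.1 τ hτ))
  rw [sdMap_apply hzero, sdMap_apply hzero]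
  refine Finset.sum_lt_sum (fun τ hτ => ?_) ⟨σ, hσ, ?_⟩
  · have h0 := (div_pos (hpos τ hτ) (hcard τ hτ)).le
    by_cases hwτ : w ∈ τ
    · rcases hc.2.2.total hσ hτ with h | h
      · rw [if_pos hwτ, if_pos (h hv)]
      · exact absurd (h hwτ) hw
    · rw [if_neg hwτ]
      split_ifs
      · exact h0
      · exact le_rfl
  · rw [if_neg hw, if_pos hv]
    exact div_pos (hpos σ hσ) (hcard σ hσ)

theorem mem_of_lt_of_mem_cell₁ {K : PreAbstractSimplicialComplex V} {c : Finset (Finset V)}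
    (hc : c ∈ sd K) {x : V → ℝ} (hx : x ∈ cell₁ c) {σ : Finset V} (hne : σ.Nonempty)
    (hsep : ∀ v ∈ σ, 0 < x v ∧ ∀ w ∉ σ, x w < x v) : σ ∈ c := by
  classical
  obtain ⟨f, ⟨hpos, hzero, hsum⟩, rfl⟩ := hx
  -- the members of the chain that contain `σ`
  have hex : (c.filter (σ ⊆ ·)).Nonempty := by
    obtain ⟨τ, hτ, htop⟩ := exists_top hc
    refine ⟨τ, Finset.mem_filter.2 ⟨hτ, fun v hv => ?_⟩⟩
    by_contra h
    have := (sdMap_mem_openSimplex hc hτ htop ⟨hpos, hzero, hsum⟩).2.1 v h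
    exact absurd this (hsep v hv).1.ne'
  obtain ⟨τ, hτ, hmin⟩ := Finset.exists_min_image (c.filter (σ ⊆ ·)) Finset.card hex
  obtain ⟨hτc, hστ⟩ := Finset.mem_filter.1 hτ
  by_contra hσc
  have hss : ∃ w ∈ τ, w ∉ σ := by
    by_contra h
    push Not at h
    exact hσc (Finset.Subset.antisymm h hστ ▸ hτc)
  obtain ⟨w, hwτ, hwσ⟩ := hss
  -- every member of the chain either contains `τ` or misses some vertex of `σ`
  have key : ∃ v ∈ σ, ∀ ρ ∈ c, v ∈ ρ → τ ⊆ ρ := by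
    have hlow : ∀ ρ ∈ c, ¬ τ ⊆ ρ → ρ ⊆ τ ∧ ¬ σ ⊆ ρ := by
      intro ρ hρ h
      have h1 := (hc.2.2.total hτc hρ).resolve_left h
      refine ⟨h1, fun h2 => h ?_⟩
      exact (Finset.eq_of_subset_of_card_le h1 (hmin ρ (Finset.mem_filter.2 ⟨hρ, h2⟩))).ge
    by_cases hemp : (c.filter (¬ τ ⊆ ·)).Nonempty
    · obtain ⟨ρ, hρ, hmax⟩ := Finset.exists_max_image (c.filter (¬ τ ⊆ ·)) Finset.card hemp
      obtain ⟨hρc, hρ'⟩ := Finset.mem_filter.1 hρ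
      obtain ⟨v, hv, hvρ⟩ := Finset.not_subset.1 (hlow ρ hρc hρ').2
      refine ⟨v, hv, fun π hπ hvπ => ?_⟩
      by_contra h
      rcases hc.2.2.total hπ hρc with h1 | h1
      · exact hvρ (h1 hvπ)
      · have := Finset.eq_of_subset_of_card_le h1 (hmax π (Finset.mem_filter.2 ⟨hπ, h⟩))
        exact hvρ (this ▸ hvπ)
    · obtain ⟨v, hv⟩ := hne
      refine ⟨v, hv, fun ρ hρ _ => ?_⟩
      by_contra h
      exact hemp ⟨ρ, Finset.mem_filter.2 ⟨hρ, h⟩⟩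
  obtain ⟨v, hv, hkey⟩ := key
  refine absurd ((hsep v hv).2 w hwσ) (not_lt.2 ?_)
  rw [sdMap_apply hzero, sdMap_apply hzero]
  refine Finset.sum_le_sum fun ρ hρ => ?_
  by_cases h : v ∈ ρ
  · rw [if_pos h, if_pos (hkey ρ hρ h hwτ)]
  · rw [if_neg h]
    split_ifs
    · exact div_nonneg (hpos ρ hρ).le (Nat.cast_nonneg _)
    · exact le_rfl

theorem exists_chain (n : ℕ) : ∀ (s : Finset V) (y : V → ℝ), s.card = n → (∀ v ∈ s, 0 < y v) →
    (∀ v ∉ s, y v = 0) → ∃ (d : Finset (Finset V)) (g : Finset V → ℝ),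
      IsChain (· ⊆ ·) (d : Set (Finset V)) ∧ (∀ σ ∈ d, σ.Nonempty ∧ σ ⊆ s) ∧
      (∀ σ ∈ d, 0 < g σ) ∧ (∀ σ ∉ d, g σ = 0) ∧ (s.Nonempty → d.Nonempty) ∧
      ∀ v, y v = ∑ᶠ (σ : Finset V) (_ : v ∈ σ), g σ := by
  classical
  induction n using Nat.strong_induction_on with
  | _ n ih =>
    intro s y hn hpos hzero
    rcases s.eq_empty_or_nonempty with rfl | hs
    · refine ⟨∅, 0, by simp, by simp, by simp, by simp, by simp, fun v => ?_⟩
      simpa using hzero v (by simp)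
    · obtain ⟨u, hu, hmin⟩ := Finset.exists_min_image s y hs
      have hlt : (s.filter (y u < y ·)) ⊂ s := by
        refine Finset.filter_ssubset.2 ⟨u, hu, lt_irrefl _⟩
      obtain ⟨d, g, h1, h2, h3, h4, -, h6⟩ := ih _ (hn ▸ Finset.card_lt_card hlt)
        (s.filter (y u < y ·)) (fun v => if v ∈ s then y v - y u else 0) rfl
        (fun v hv => by
          obtain ⟨hv1, hv2⟩ := Finset.mem_filter.1 hv
          simpa [hv1] using hv2)
        (fun v hv => by
          by_cases hvs : v ∈ s
          · have := le_antisymm (not_lt.1 fun h => hv (Finset.mem_filter.2 ⟨hvs, h⟩)) (hmin v hvs)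
            simp [this]
          · simp [hvs])
      have hsd : s ∉ d := fun h => hlt.not_subset ((h2 s h).2)
      have hds : ∀ σ ∈ d, σ ⊆ s := fun σ hσ => (h2 σ hσ).2.trans hlt.subset
      refine ⟨insert s d, Function.update g s (y u), ?_, ?_, ?_, ?_, ?_, ?_⟩
      · rw [Finset.coe_insert]
        exact h1.insert fun σ hσ _ => Or.inr (hds σ hσ)
      · intro σ hσ
        rcases Finset.mem_insert.1 hσ with rfl | hσ
        · exact ⟨hs, subset_rfl⟩
        · exact ⟨(h2 σ hσ).1, hds σ hσ⟩
      · intro σ hσ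
        rcases Finset.mem_insert.1 hσ with rfl | hσ'
        · simpa using hpos u hu
        · rw [Function.update_of_ne (by rintro rfl; exact hsd hσ')]
          exact h3 σ hσ'
      · intro σ hσ
        rw [Finset.mem_insert, not_or] at hσ
        rw [Function.update_of_ne hσ.1]
        exact h4 σ hσ.2
      · exact fun _ => Finset.insert_nonempty _ _
      · intro v
        have e : ∀ (g : Finset V → ℝ) (σ : Finset V), (∑ᶠ (_ : v ∈ σ), g σ) =
            if v ∈ σ then g σ else 0 := fun g σ => finsum_eq_if
        have hsupp : ∀ (g : Finset V → ℝ) (d : Finset (Finset V)), (∀ σ ∉ d, g σ = 0) →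
            (∑ᶠ (σ : Finset V) (_ : v ∈ σ), g σ) = ∑ σ ∈ d, if v ∈ σ then g σ else 0 := by
          intro g d hd
          simp_rw [e]
          refine finsum_eq_sum_of_support_subset _ fun σ hσ => ?_
          by_contra hc
          apply hσ
          simp [hd σ hc]
        have h6v := h6 v
        rw [hsupp g d h4] at h6v
        rw [hsupp _ (insert s d) (fun σ hσ => by
          rw [Finset.mem_insert, not_or] at hσ
          rw [Function.update_of_ne hσ.1]
          exact h4 σ hσ.2), Finset.sum_insert hsd]
        have : (∑ σ ∈ d, if v ∈ σ then Function.update g s (y u) σ else 0) =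
            ∑ σ ∈ d, if v ∈ σ then g σ else 0 :=
          Finset.sum_congr rfl fun σ hσ => by
            rw [Function.update_of_ne (by rintro rfl; exact hsd hσ)]
        rw [this, ← h6v, Function.update_self]
        by_cases hvs : v ∈ s
        · simp [hvs]
        · simp [hvs, hzero v hvs]

theorem exists_mem_cell₁ {K : PreAbstractSimplicialComplex V} {s : Finset V} (hs : s ∈ K)
    {x : V → ℝ} (hx : x ∈ openSimplex s) : ∃ c ∈ sd K, x ∈ cell₁ c := by
  classical
  obtain ⟨hpos, hzero, hsum⟩ := hx
  obtain ⟨d, g, h1, h2, h3, h4, h5, h6⟩ := exists_chain _ s x rfl hpos hzero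
  have hcard : ∀ τ ∈ d, 0 < (τ.card : ℝ) := fun τ hτ => by
    exact_mod_cast Finset.card_pos.2 (h2 τ hτ).1
  have hfg : ∀ σ : Finset V, (σ.card : ℝ) * g σ / σ.card = g σ := by
    intro σ
    by_cases hσ : σ ∈ d
    · rw [mul_div_cancel_left₀ _ (hcard σ hσ).ne']
    · simp [h4 σ hσ]
  have hmap : sdMap (fun σ => (σ.card : ℝ) * g σ) = x := by
    funext v
    rw [sdMap, h6 v]
    simp_rw [hfg]
  have hz : ∀ σ ∉ d, (σ.card : ℝ) * g σ = 0 := fun σ hσ => by simp [h4 σ hσ]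
  refine ⟨d, ⟨h5 (mem_nonempty hs), fun σ hσ => (K.isRelLowerSet_faces hs).2 (h2 σ hσ).2 (h2 σ hσ).1,
    h1⟩, _, ⟨fun σ hσ => mul_pos (hcard σ hσ) (h3 σ hσ), hz, ?_⟩, hmap⟩
  rw [← hsum, ← hmap]
  simp_rw [sdMap_apply hz]
  rw [Finset.sum_comm]
  refine Finset.sum_congr rfl fun τ hτ => ?_
  rw [← Finset.sum_filter, Finset.sum_const, Finset.filter_mem_eq_inter,
    Finset.inter_eq_right.2 (h2 τ hτ).2, nsmul_eq_mul, mul_div_cancel₀ _ (hcard τ hτ).ne']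

theorem convex_cell₁ {c d : Finset (Finset V)} (hcd : c ⊆ d)
    {x y : V → ℝ} (hx : x ∈ cell₁ c) (hy : y ∈ cell₁ d) {a b : ℝ} (ha : 0 ≤ a) (hb : 0 < b)
    (hab : a + b = 1) : a • x + b • y ∈ cell₁ d := by
  classical
  obtain ⟨f, ⟨f1, f2, f3⟩, rfl⟩ := hx
  obtain ⟨g, ⟨g1, g2, g3⟩, rfl⟩ := hy
  have f2' : ∀ σ ∉ d, f σ = 0 := fun σ hσ => f2 σ fun h => hσ (hcd h)
  have f0 : ∀ σ, 0 ≤ f σ := fun σ => by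
    by_cases h : σ ∈ c
    · exact (f1 σ h).le
    · rw [f2 σ h]
  have f3' : ∑ σ ∈ d, f σ = 1 := by
    rw [← f3]
    exact (Finset.sum_subset hcd fun σ _ h => f2 σ h).symm
  refine ⟨a • f + b • g, ⟨fun σ hσ => ?_, fun σ hσ => ?_, ?_⟩, ?_⟩
  · exact add_pos_of_nonneg_of_pos (mul_nonneg ha (f0 σ)) (mul_pos hb (g1 σ hσ))
  · simp [f2' σ hσ, g2 σ hσ]
  · simp [Finset.sum_add_distrib, ← Finset.mul_sum, f3', g3, hab]
  · funext v
    rw [sdMap_apply (c := d) (fun σ hσ => by simp [f2' σ hσ, g2 σ hσ])]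
    simp only [Pi.add_apply, Pi.smul_apply, smul_eq_mul]
    rw [sdMap_apply f2', sdMap_apply g2, Finset.mul_sum, Finset.mul_sum, ← Finset.sum_add_distrib]
    refine Finset.sum_congr rfl fun σ _ => ?_
    split_ifs
    · ring
    · ring

theorem openSimplex_inj {s t : Finset V} {x : V → ℝ} (hs : x ∈ openSimplex s)
    (ht : x ∈ openSimplex t) : s = t := by
  ext v
  constructor
  · intro h
    by_contra h'
    exact (hs.1 v h).ne' (ht.2.1 v h')
  · intro h
    by_contra h'
    exact (ht.1 v h).ne' (hs.2.1 v h')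

theorem cell₁_inj {K : PreAbstractSimplicialComplex V} {c d : Finset (Finset V)} (hc : c ∈ sd K)
    (hd : d ∈ sd K) {x : V → ℝ} (hxc : x ∈ cell₁ c) (hxd : x ∈ cell₁ d) : c = d := by
  have key : ∀ c ∈ sd K, ∀ d ∈ sd K, x ∈ cell₁ c → x ∈ cell₁ d → c ⊆ d := by
    intro c hc d hd hxc hxd σ hσ
    refine mem_of_lt_of_mem_cell₁ hd hxd (mem_nonempty (hc.2.1 σ hσ)) fun v hv =>
      ⟨?_, fun w hw => lt_of_mem_cell₁ hc hxc hσ hv hw⟩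
    obtain ⟨τ, hτ, htop⟩ := exists_top hc
    obtain ⟨f, hf, rfl⟩ := hxc
    exact (sdMap_mem_openSimplex hc hτ htop hf).1 v (htop σ hσ hv)
  exact (key c hc d hd hxc hxd).antisymm (key d hd c hc hxd hxc)

theorem sdMap_inj {K : PreAbstractSimplicialComplex V} {c d : Finset (Finset V)} (hc : c ∈ sd K)
    (hd : d ∈ sd K) {f g : Finset V → ℝ} (hf : f ∈ openSimplex c) (hg : g ∈ openSimplex d)
    (h : sdMap f = sdMap g) : f = g := by
  classical
  obtain rfl : c = d := cell₁_inj hc hd ⟨f, hf, rfl⟩ ⟨g, hg, h.symm⟩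
  by_contra hne
  have hex : (c.filter fun σ => f σ ≠ g σ).Nonempty := by
    obtain ⟨σ, hσ⟩ := Function.ne_iff.1 hne
    refine ⟨σ, Finset.mem_filter.2 ⟨?_, hσ⟩⟩
    by_contra hσc
    exact hσ ((hf.2.1 σ hσc).trans (hg.2.1 σ hσc).symm)
  obtain ⟨σ, hσ, hmax⟩ := Finset.exists_max_image _ Finset.card hex
  obtain ⟨hσc, hσfg⟩ := Finset.mem_filter.1 hσ
  -- a vertex of `σ` that lies in no smaller member of the chain
  have hv : ∃ v ∈ σ, ∀ τ ∈ c, v ∈ τ → σ ⊆ τ := by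
    by_cases hemp : (c.filter (· ⊂ σ)).Nonempty
    · obtain ⟨ρ, hρ, hρmax⟩ := Finset.exists_max_image (c.filter (· ⊂ σ)) Finset.card hemp
      obtain ⟨hρc, hρσ⟩ := Finset.mem_filter.1 hρ
      obtain ⟨v, hv, hvρ⟩ := Finset.exists_of_ssubset hρσ
      refine ⟨v, hv, fun τ hτ hvτ => ?_⟩
      by_contra hn
      have hτσ : τ ⊂ σ := ⟨(hc.2.2.total hσc hτ).resolve_left hn, hn⟩
      rcases hc.2.2.total hτ hρc with h1 | h1
      · exact hvρ (h1 hvτ)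
      · have := Finset.eq_of_subset_of_card_le h1 (hρmax τ (Finset.mem_filter.2 ⟨hτ, hτσ⟩))
        exact hvρ (this ▸ hvτ)
    · obtain ⟨v, hv⟩ := mem_nonempty (hc.2.1 σ hσc)
      refine ⟨v, hv, fun τ hτ _ => ?_⟩
      by_contra hn
      exact hemp ⟨τ, Finset.mem_filter.2 ⟨hτ, (hc.2.2.total hσc hτ).resolve_left hn, hn⟩⟩
  obtain ⟨v, hvσ, hv⟩ := hv
  have hsum := congrFun h v
  rw [sdMap_apply hf.2.1, sdMap_apply hg.2.1, ← sub_eq_zero, ← Finset.sum_sub_distrib,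
    Finset.sum_eq_single_of_mem σ hσc, if_pos hvσ, if_pos hvσ, ← sub_div] at hsum
  · rcases div_eq_zero_iff.1 hsum with h0 | h0
    · exact hσfg (sub_eq_zero.1 h0)
    · have := Finset.card_pos.2 (mem_nonempty (hc.2.1 σ hσc))
      exact this.ne' (by exact_mod_cast h0)
  · intro τ hτ hτσ
    by_cases hvτ : v ∈ τ
    · have hfg : f τ = g τ := by
        by_contra hn
        have := hmax τ (Finset.mem_filter.2 ⟨hτ, hn⟩)
        exact hτσ (Finset.eq_of_subset_of_card_le (hv τ hτ hvτ) this).symm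
      rw [hfg, sub_self]
    · rw [if_neg hvτ, if_neg hvτ, sub_self]

theorem cell₂_inj {K : PreAbstractSimplicialComplex V} {C D : Finset (Finset (Finset V))}
    (hC : C ∈ sd (sd K)) (hD : D ∈ sd (sd K)) {x : V → ℝ} (hxC : x ∈ cell₂ C)
    (hxD : x ∈ cell₂ D) : C = D := by
  obtain ⟨_, ⟨f, hf, rfl⟩, rfl⟩ := hxC
  obtain ⟨_, ⟨g, hg, rfl⟩, h⟩ := hxD
  obtain ⟨c, hc, hct⟩ := exists_top hC
  obtain ⟨d, hd, hdt⟩ := exists_top hD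
  have := sdMap_inj (hC.2.1 c hc) (hD.2.1 d hd) (sdMap_mem_openSimplex hC hc hct hf)
    (sdMap_mem_openSimplex hD hd hdt hg) h.symm
  exact cell₁_inj hC hD ⟨f, hf, rfl⟩ ⟨g, hg, this.symm⟩

end Simplicial

section Topological

/-- A simplicial pair `(K, K₀)`: a simplicial complex together with a subcomplex. -/
structure SimplicialPair (V : Type v) where
  /-- the simplicial complex -/
  K : PreAbstractSimplicialComplex V
  /-- the subcomplex -/
  K₀ : PreAbstractSimplicialComplex V
  le : K₀ ≤ K

/-- The space `|K - K₀|`: the union of the open simplices of `K` that are not in `K₀`.  It carries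
the topology of pointwise convergence of barycentric coordinates.  As soon as this space is locally
compact, each simplex of `K - K₀` lies in finitely many simplices of `K`, and then this is also the
topology induced from the weak topology of `|K|`. -/
def SimplicialPair.space {V : Type v} (P : SimplicialPair V) : Set (V → ℝ) :=
  {x | ∃ s ∈ P.K, s ∉ P.K₀ ∧ x ∈ openSimplex s}

/-- A triangulation of `X`: a simplicial pair and a homeomorphism `|K - K₀| ≃ X`.  The strata are
the images of the open simplices in `K - K₀`. -/
structure Triangulation (X : Type u) [TopologicalSpace X] (V : Type v) extends
    SimplicialPair V where
  /-- the homeomorphism onto `X` -/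
  homeo : toSimplicialPair.space ≃ₜ X

namespace Triangulation

variable {X : Type u} [TopologicalSpace X] {V : Type v} (T : Triangulation X V)

/-- The barycentric coordinates of a point of a triangulated space. -/
def coord (x : X) : V → ℝ := (T.homeo.symm x).1

theorem coord_mem (x : X) : T.coord x ∈ T.space := (T.homeo.symm x).2

theorem coord_homeo (y : T.space) : T.coord (T.homeo y) = y.1 := by simp [coord]

theorem isEmbedding_coord : Topology.IsEmbedding T.coord :=
  Topology.IsEmbedding.subtypeVal.comp T.homeo.symm.isEmbedding

theorem isConnected_of_starConvex {U : Set X} {x : X} (hx : x ∈ U)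
    (h : StarConvex ℝ (T.coord x) (T.coord '' U)) : IsConnected U := by
  refine ⟨⟨x, hx⟩, ?_⟩
  rw [← T.isEmbedding_coord.isInducing.isPreconnected_image]
  exact (StarConvex.isPathConnected h ⟨x, hx, rfl⟩).isConnected.isPreconnected

/-- A basic open set `U` of `X` associated to the simplex `s`, for a subdivision `J` of `K` whose
simplex `t` occupies the cell `cell t ⊆ |K|`: an open set that contains a point of the open simplex
`s`, lies in the open star of `s`, and is star-shaped about that point in barycentric coordinates.
(These are images of local parametrizations `ℝᵈ × C(L) → X` of the stratified space, and they form
a basis of the topology which contains the open stars of all simplices.) -/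
def IsBasicAt {I : Type w} (J : PreAbstractSimplicialComplex I) (cell : Finset I → Set (V → ℝ))
    (s : Finset I) (U : Opens X) : Prop :=
  s ∈ J ∧ (∀ y ∈ U, ∃ t ∈ J, s ⊆ t ∧ T.coord y ∈ cell t) ∧
    ∃ x ∈ U, T.coord x ∈ cell s ∧ StarConvex ℝ (T.coord x) (T.coord '' (U : Set X))

/-- `U` is a basic open set of the triangulation by `K`. -/
def IsBasic (U : Opens X) : Prop := ∃ σ, T.IsBasicAt T.K openSimplex σ U

/-- `U` is a basic open set of the second subdivision `K²`, associated to a simplex `C` of `K²`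
whose image `Σ(C)` under the dilation is not in the first subdivision of `K₀`, that is, which `Σ`
maps into `X = |K - K₀|`. -/
def IsDilationBasic (U : Opens X) : Prop :=
  ∃ C, dilation C ∉ sd T.K₀ ∧ T.IsBasicAt (sd (sd T.K)) cell₂ C U

/-- The open star in `X` of the simplex `e` of the first subdivision `K¹`. -/
def star₁ (e : Finset (Finset V)) : Set X :=
  {x | ∃ d ∈ sd T.K, e ⊆ d ∧ T.coord x ∈ cell₁ d}

/-- The union of the sets `st Σ(C)` over all simplices `C` of `K²` that meet `U`.  If `U` is a basic
open set of `K²` associated to `C`, then this is `st Σ(C)`, see `dilateSet_eq`. -/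
def dilateSet (U : Set X) : Set X :=
  {y | ∃ C ∈ sd (sd T.K), (∃ x ∈ U, T.coord x ∈ cell₂ C) ∧ y ∈ T.star₁ (dilation C)}

/-- The part `|L² - cl st L₀²|` of a space triangulated by a simplicial pair `(L, L₀)`.  It is the
union of the open simplices outside a subcomplex of `L²`, hence open if the space is a manifold; its
open sets are the open sets of the whole space that it contains. -/
def shrinking : Set X :=
  {x | ∃ C ∈ sd (sd T.K), C ∉ closedStar (sd (sd T.K)) (sd (sd T.K₀)) ∧ T.coord x ∈ cell₂ C}

theorem exists_star₁ (x : X) : ∃ d ∈ sd T.K, T.coord x ∈ cell₁ d := by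
  obtain ⟨s, hs, -, hx⟩ := T.coord_mem x
  exact exists_mem_cell₁ hs hx

theorem mem_space_of_mem_cell₁ {d : Finset (Finset V)} (hd : d ∈ sd T.K) (hd₀ : d ∉ sd T.K₀)
    {x : V → ℝ} (hx : x ∈ cell₁ d) : x ∈ T.space := by
  obtain ⟨σ, hσ, htop⟩ := exists_top hd
  obtain ⟨f, hf, rfl⟩ := hx
  refine ⟨σ, hd.2.1 σ hσ, fun h => hd₀ ⟨hd.1, fun τ hτ => ?_, hd.2.2⟩,
    sdMap_mem_openSimplex hd hσ htop hf⟩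
  exact (T.K₀.isRelLowerSet_faces h).2 (htop τ hτ) (mem_nonempty (hd.2.1 τ hτ))

theorem isOpen_star₁ {e : Finset (Finset V)} (he : e ∈ sd T.K) : IsOpen (T.star₁ e) := by
  classical
  have hcont : ∀ v, Continuous fun y => T.coord y v := fun v =>
    (continuous_apply v).comp T.isEmbedding_coord.continuous
  have h : T.star₁ e =
      ⋂ σ ∈ e, {y | ∀ v ∈ σ, 0 < T.coord y v ∧ ∀ w ∉ σ, T.coord y w < T.coord y v} := by
    ext y
    simp only [Set.mem_iInter, Set.mem_ofPred_eq]
    constructor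
    · rintro ⟨d, hd, hed, hy⟩ σ hσ v hv
      refine ⟨?_, fun w hw => lt_of_mem_cell₁ hd hy (hed hσ) hv hw⟩
      obtain ⟨τ, hτ, htop⟩ := exists_top hd
      obtain ⟨f, hf, hfy⟩ := hy
      rw [← hfy]
      exact (sdMap_mem_openSimplex hd hτ htop hf).1 v (htop σ (hed hσ) hv)
    · intro hy
      obtain ⟨d, hd, hyd⟩ := T.exists_star₁ y
      exact ⟨d, hd, fun σ hσ =>
        mem_of_lt_of_mem_cell₁ hd hyd (mem_nonempty (he.2.1 σ hσ)) (hy σ hσ), hyd⟩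
  rw [h]
  refine isOpen_biInter_finset fun σ _ => isOpen_iff_mem_nhds.2 fun x hx => ?_
  obtain ⟨s, -, -, -, hs0, hs1⟩ := T.coord_mem x
  -- only finitely many coordinates matter near `x`
  have hN : (⋂ v ∈ σ, ({y | 0 < T.coord y v} ∩ {y | 1 - ∑ u ∈ s, T.coord y u < T.coord y v} ∩
      ⋂ w ∈ s \ σ, {y | T.coord y w < T.coord y v})) ∈ nhds x := by
    refine (isOpen_biInter_finset fun v _ => ((isOpen_lt continuous_const (hcont v)).inter
      (isOpen_lt (continuous_const.sub (continuous_finsetSum _ fun u _ => hcont u))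
        (hcont v))).inter (isOpen_biInter_finset fun w _ => isOpen_lt (hcont w) (hcont v))).mem_nhds
      ?_
    refine Set.mem_iInter₂.2 fun v hv => ⟨⟨(hx v hv).1, ?_⟩, Set.mem_iInter₂.2 fun w hw =>
      (hx v hv).2 w (Finset.mem_sdiff.1 hw).2⟩
    change 1 - ∑ u ∈ s, T.coord x u < T.coord x v
    rw [hs1, sub_self]
    exact (hx v hv).1
  refine Filter.mem_of_superset hN fun y hy v hv => ?_
  obtain ⟨⟨h1, h2⟩, h3⟩ := Set.mem_iInter₂.1 hy v hv
  refine ⟨h1, fun w hw => ?_⟩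
  by_cases hws : w ∈ s
  · exact Set.mem_iInter₂.1 h3 w (Finset.mem_sdiff.2 ⟨hws, hw⟩)
  · refine lt_of_le_of_lt ?_ h2
    obtain ⟨t, -, -, ht⟩ := T.coord_mem y
    have h0 : ∀ u, 0 ≤ T.coord y u := fun u => by
      by_cases hu : u ∈ t
      · exact (ht.1 u hu).le
      · exact (ht.2.1 u hu).ge
    have h4 : ∑ u ∈ insert w s, T.coord y u ≤ 1 := by
      rw [← ht.2.2]
      calc ∑ u ∈ insert w s, T.coord y u ≤ ∑ u ∈ insert w s ∪ t, T.coord y u :=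
            Finset.sum_le_sum_of_subset_of_nonneg Finset.subset_union_left fun u _ _ => h0 u
        _ = ∑ u ∈ t, T.coord y u :=
            (Finset.sum_subset Finset.subset_union_right fun u _ hu => ht.2.1 u hu).symm
    rw [Finset.sum_insert hws] at h4
    linarith

theorem isConnected_star₁ {e : Finset (Finset V)} (he : e ∈ sd T.K) (he₀ : e ∉ sd T.K₀) :
    IsConnected (T.star₁ e) := by
  classical
  have hcell : (cell₁ e).Nonempty := by
    refine ⟨_, fun σ => if σ ∈ e then (e.card : ℝ)⁻¹ else 0, ⟨fun σ hσ => ?_, fun σ hσ => ?_, ?_⟩,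
      rfl⟩
    · simp only [if_pos hσ]
      exact inv_pos.2 (by exact_mod_cast Finset.card_pos.2 he.1)
    · simp only [if_neg hσ]
    · rw [Finset.sum_congr rfl fun σ hσ => if_pos hσ, Finset.sum_const, nsmul_eq_mul]
      exact mul_inv_cancel₀ (by exact_mod_cast (Finset.card_pos.2 he.1).ne')
  obtain ⟨z, hz⟩ := hcell
  have hzs := T.mem_space_of_mem_cell₁ he he₀ hz
  have hzx : T.coord (T.homeo ⟨z, hzs⟩) = z := T.coord_homeo _
  refine T.isConnected_of_starConvex (x := T.homeo ⟨z, hzs⟩)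
    ⟨e, he, subset_rfl, by rwa [hzx]⟩ ?_
  rw [hzx]
  rintro _ ⟨y, ⟨d, hd, hed, hy⟩, rfl⟩ a b ha hb hab
  rcases hb.eq_or_lt with rfl | hb
  · refine ⟨T.homeo ⟨z, hzs⟩, ⟨e, he, subset_rfl, by rwa [hzx]⟩, ?_⟩
    rw [hzx, show a = 1 by linarith]
    simp
  · have h1 := convex_cell₁ hed hz hy ha hb hab
    have hd₀ : d ∉ sd T.K₀ := fun h =>
      he₀ ⟨he.1, fun σ hσ => h.2.1 σ (hed hσ), he.2.2⟩
    have h2 := T.mem_space_of_mem_cell₁ hd hd₀ h1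
    exact ⟨T.homeo ⟨_, h2⟩, ⟨d, hd, hed, by rwa [T.coord_homeo]⟩, T.coord_homeo _⟩

variable {T}

theorem IsBasic.isConnected {U : Opens X} (h : T.IsBasic U) : IsConnected (U : Set X) := by
  obtain ⟨σ, -, -, x, hx, -, hs⟩ := h
  exact T.isConnected_of_starConvex hx hs

/-- A basic open set of the second subdivision is a basic open set. -/
theorem IsDilationBasic.isBasic {U : Opens X} (h : T.IsDilationBasic U) : T.IsBasic U := by
  obtain ⟨C, -, hC, hU, x, hxU, hx, hs⟩ := h
  have key : ∀ C ∈ sd (sd T.K), ∃ c ∈ C, (∀ c' ∈ C, c' ⊆ c) ∧ ∃ σ ∈ c, (∀ τ ∈ c, τ ⊆ σ) ∧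
      σ ∈ T.K ∧ cell₂ C ⊆ openSimplex σ := by
    intro C hC
    obtain ⟨c, hc, htop⟩ := exists_top hC
    obtain ⟨σ, hσ, htop'⟩ := exists_top (hC.2.1 c hc)
    refine ⟨c, hc, htop, σ, hσ, htop', (hC.2.1 c hc).2.1 σ hσ, ?_⟩
    rintro _ ⟨_, ⟨f, hf, rfl⟩, rfl⟩
    exact sdMap_mem_openSimplex (hC.2.1 c hc) hσ htop' (sdMap_mem_openSimplex hC hc htop hf)
  obtain ⟨c, hc, -, σ, hσ, -, hσK, hσx⟩ := key C hC
  refine ⟨σ, hσK, fun y hy => ?_, x, hxU, hσx hx, hs⟩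
  obtain ⟨C', hC', hCC', hyC'⟩ := hU y hy
  obtain ⟨c', hc', htop, τ, hτ, htop', hτK, hτy⟩ := key C' hC'
  exact ⟨τ, hτK, htop' σ (htop c (hCC' hc) hσ), hτy hyC'⟩

/-- On a basic open set `U` of `K²` associated to `C`, the dilation is `st Σ(C)`. -/
theorem dilateSet_eq {U : Opens X} {C : Finset (Finset (Finset V))}
    (h : T.IsBasicAt (sd (sd T.K)) cell₂ C U) : T.dilateSet U = T.star₁ (dilation C) := by
  classical
  obtain ⟨hC, hU, x, hxU, hx, -⟩ := h
  ext y
  constructor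
  · rintro ⟨D, hD, ⟨z, hzU, hz⟩, d, hd, hDd, hy⟩
    obtain ⟨C', hC', hCC', hzC'⟩ := hU z hzU
    obtain rfl := cell₂_inj hD hC' hz hzC'
    exact ⟨d, hd, (Finset.image_subset_image hCC').trans hDd, hy⟩
  · exact fun hy => ⟨C, hC, ⟨x, hxU, hx⟩, hy⟩

theorem IsDilationBasic.isOpen {U : Opens X} (h : T.IsDilationBasic U) :
    IsOpen (T.dilateSet U) := by
  obtain ⟨C, -, hC⟩ := h
  rw [dilateSet_eq hC]
  exact T.isOpen_star₁ (dilation_mem hC.1)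

theorem IsDilationBasic.isConnected {U : Opens X} (h : T.IsDilationBasic U) :
    IsConnected (T.dilateSet U) := by
  obtain ⟨C, hC₀, hC⟩ := h
  rw [dilateSet_eq hC]
  exact T.isConnected_star₁ (dilation_mem hC.1) hC₀

theorem dilateSet_mono {U V : Set X} (h : U ⊆ V) : T.dilateSet U ⊆ T.dilateSet V := by
  rintro y ⟨C, hC, ⟨x, hx, hxC⟩, hy⟩
  exact ⟨C, hC, ⟨x, h hx, hxC⟩, hy⟩

end Triangulation
end Topological

section Sheaves

/-- The poset of non-empty connected open sets. -/
abbrev ConnOpens (X : Type u) [TopologicalSpace X] : Type u :=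
  {U : Opens X // IsConnected (U : Set X)}

/-- A bisheaf around `X`: a sheaf, a cosheaf, and for each non-empty connected open set `U` a map
from the sections of the sheaf to those of the cosheaf, compatible with all inclusions `V ⊆ U`. -/
structure Bisheaf (X : Type u) [TopologicalSpace X] where
  /-- the sheaf -/
  sheaf : (Opens X)ᵒᵖ ⥤ AddCommGrpCat.{w}
  isSheaf : TopCat.Presheaf.IsSheaf (X := TopCat.of X) sheaf
  /-- the cosheaf -/
  cosheaf : Opens X ⥤ AddCommGrpCat.{w}
  isCosheaf : TopCat.Presheaf.IsSheaf (X := TopCat.of X) (C := AddCommGrpCat.{w}ᵒᵖ) cosheaf.op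
  /-- the maps from the sheaf to the cosheaf -/
  map : ∀ U : ConnOpens X, sheaf.obj (op U.1) ⟶ cosheaf.obj U.1
  comm : ∀ {V U : ConnOpens X} (f : V.1 ⟶ U.1),
    sheaf.map f.op ≫ map V ≫ cosheaf.map f = map U

/-- A bisheaf recorded by its values on the members of a poset `B` of open sets (in the cases below,
a basis of the topology by connected open sets, which determines a constructible bisheaf). -/
structure BisheafOn (B : Type v) [Preorder B] where
  /-- the values of the sheaf -/
  sheaf : Bᵒᵖ ⥤ AddCommGrpCat.{w}
  /-- the values of the cosheaf -/
  cosheaf : B ⥤ AddCommGrpCat.{w}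
  /-- the maps from the sheaf to the cosheaf -/
  map : ∀ U : B, sheaf.obj (op U) ⟶ cosheaf.obj U
  comm : ∀ {V U : B} (f : V ⟶ U), sheaf.map f.op ≫ map V ≫ cosheaf.map f = map U

/-- A local system, recorded (as a colocal system) by its values on a basis `B` of the topology by
connected open sets: a functor that sends every inclusion to an isomorphism. -/
structure LocalSystem (B : Type v) [Preorder B] where
  /-- the underlying functor -/
  functor : B ⥤ AddCommGrpCat.{w}
  isIso : ∀ {V U : B} (f : V ⟶ U), IsIso (functor.map f)

namespace BisheafOn
variable {B : Type v} [Preorder B] {B' : Type v'} [Preorder B']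

/-- Pull-back of a bisheaf along a monotone map between the indexing posets. -/
def pullback (F : BisheafOn.{v, w} B) (f : B' →o B) : BisheafOn.{v', w} B' where
  sheaf := f.monotone.functor.op ⋙ F.sheaf
  cosheaf := f.monotone.functor ⋙ F.cosheaf
  map U := F.map (f U)
  comm g := F.comm (f.monotone.functor.map g)

/-- A family of subgroups is a sub-episheaf if every restriction map carries it onto itself.  If
the sheaf is constructible then such a subsheaf is constructible too. -/
def IsSubEpisheaf (F : Bᵒᵖ ⥤ AddCommGrpCat.{w}) (E : ∀ U, AddSubgroup (F.obj U)) : Prop :=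
  ∀ ⦃U V : Bᵒᵖ⦄ (f : U ⟶ V), (E U).map (F.map f).hom = E V

/-- The maximal sub-episheaf, the sum of all sub-episheaves. -/
def epiSubgroup (F : Bᵒᵖ ⥤ AddCommGrpCat.{w}) (U : Bᵒᵖ) : AddSubgroup (F.obj U) :=
  ⨆ E : {E : ∀ U, AddSubgroup (F.obj U) // IsSubEpisheaf F E}, E.1 U

theorem epiSubgroup_isSubEpisheaf (F : Bᵒᵖ ⥤ AddCommGrpCat.{w}) :
    IsSubEpisheaf F (epiSubgroup F) := by
  intro U V f
  unfold epiSubgroup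
  rw [AddSubgroup.map_iSup]
  exact iSup_congr fun E => E.2 f

/-- Epification: the maximal sub-episheaf, as a functor. -/
def epi (F : Bᵒᵖ ⥤ AddCommGrpCat.{w}) : Bᵒᵖ ⥤ AddCommGrpCat.{w} where
  obj U := AddCommGrpCat.of (epiSubgroup F U)
  map {U V} f := AddCommGrpCat.ofHom
    (((F.map f).hom.comp (epiSubgroup F U).subtype).codRestrict (epiSubgroup F V) fun x => by
      rw [← epiSubgroup_isSubEpisheaf F f]
      exact ⟨x.1, x.2, rfl⟩)
  map_id U := by ext x; exact congrArg (fun k => k.hom x.1) (F.map_id U)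
  map_comp f g := by ext x; exact congrArg (fun k => k.hom x.1) (F.map_comp f g)

/-- A family of subgroups is the kernel of a quotient-monocosheaf if the extension maps induce
injective maps of the quotients, that is, if each subgroup is the preimage of the next.  If the
cosheaf is constructible then so is the quotient. -/
def IsMonoKernel (G : B ⥤ AddCommGrpCat.{w}) (N : ∀ U, AddSubgroup (G.obj U)) : Prop :=
  ∀ ⦃V U : B⦄ (f : V ⟶ U), (N U).comap (G.map f).hom = N V

/-- The kernel of the minimal quotient-monocosheaf. -/
def monoKernel (G : B ⥤ AddCommGrpCat.{w}) (U : B) : AddSubgroup (G.obj U) :=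
  ⨅ N : {N : ∀ U, AddSubgroup (G.obj U) // IsMonoKernel G N}, N.1 U

theorem monoKernel_isMonoKernel (G : B ⥤ AddCommGrpCat.{w}) :
    IsMonoKernel G (monoKernel G) := by
  intro V U f
  unfold monoKernel
  rw [AddSubgroup.comap_iInf]
  exact iInf_congr fun N => N.2 f

/-- Monofication: the minimal quotient-monocosheaf. -/
def mono (G : B ⥤ AddCommGrpCat.{w}) : B ⥤ AddCommGrpCat.{w} where
  obj U := AddCommGrpCat.of (G.obj U ⧸ monoKernel G U)
  map {V U} f := AddCommGrpCat.ofHom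
    (QuotientAddGroup.map (monoKernel G V) (monoKernel G U) (G.map f).hom
      (monoKernel_isMonoKernel G f).ge)
  map_id U := by
    ext x
    exact congrArg (fun k => QuotientAddGroup.mk' (monoKernel G U) (k.hom x)) (G.map_id U)
  map_comp {U V W} f g := by
    ext x
    exact congrArg (fun k => QuotientAddGroup.mk' (monoKernel G W) (k.hom x)) (G.map_comp f g)

/-- Isofication. -/
def iso (F : BisheafOn.{v, w} B) : BisheafOn.{v, w} B where
  sheaf := epi F.sheaf
  cosheaf := mono F.cosheaf
  map U := AddCommGrpCat.ofHom
    ((QuotientAddGroup.mk' (monoKernel F.cosheaf U)).comp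
      ((F.map U).hom.comp (epiSubgroup F.sheaf (op U)).subtype))
  comm {V U} f := by
    ext x
    have h := congrArg (fun k => k.hom x.1) (F.comm f)
    exact congrArg (QuotientAddGroup.mk' (monoKernel F.cosheaf U)) h

/-- Isobisheaves: the sheaf is an episheaf and the cosheaf is a monocosheaf. -/
structure IsIsobisheaf (F : BisheafOn.{v, w} B) : Prop where
  surjective : ∀ ⦃U V : Bᵒᵖ⦄ (f : U ⟶ V), Function.Surjective (F.sheaf.map f).hom
  injective : ∀ ⦃V U : B⦄ (f : V ⟶ U), Function.Injective (F.cosheaf.map f).hom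

theorem isIsobisheaf_iso (F : BisheafOn.{v, w} B) : F.iso.IsIsobisheaf where
  surjective U V f := by
    rintro ⟨y, hy⟩
    rw [← epiSubgroup_isSubEpisheaf F.sheaf f] at hy
    obtain ⟨x, hx, rfl⟩ := hy
    exact ⟨⟨x, hx⟩, rfl⟩
  injective V U f := by
    refine (injective_iff_map_eq_zero _).2 fun x hx => ?_
    obtain ⟨x, rfl⟩ := QuotientAddGroup.mk_surjective x
    refine (QuotientAddGroup.eq_zero_iff x).2 ?_
    rw [← monoKernel_isMonoKernel F.cosheaf f]
    exact (QuotientAddGroup.eq_zero_iff ((F.cosheaf.map f).hom x)).1 hx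

theorem IsIsobisheaf.pullback {F : BisheafOn.{v, w} B} (h : F.IsIsobisheaf) (f : B' →o B) :
    (F.pullback f).IsIsobisheaf where
  surjective _ _ g := h.surjective (f.monotone.functor.op.map g)
  injective _ _ g := h.injective (f.monotone.functor.map g)

theorem IsIsobisheaf.map_mem_range {F : BisheafOn.{v, w} B} (h : F.IsIsobisheaf) {V U : B}
    (f : V ⟶ U) (y : F.cosheaf.obj V) (hy : y ∈ (F.map V).hom.range) :
    (F.cosheaf.map f).hom y ∈ (F.map U).hom.range := by
  obtain ⟨z, rfl⟩ := hy
  obtain ⟨x, rfl⟩ := h.surjective f.op z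
  exact ⟨x, (congrArg (fun k => k.hom x) (F.comm f)).symm⟩

/-- The image of an isobisheaf, a local system. -/
def image (F : BisheafOn.{v, w} B) (h : F.IsIsobisheaf) : LocalSystem.{v, w} B where
  functor :=
    { obj := fun U => AddCommGrpCat.of (F.map U).hom.range
      map := fun {V U} f => AddCommGrpCat.ofHom
        (((F.cosheaf.map f).hom.comp (F.map V).hom.range.subtype).codRestrict (F.map U).hom.range
          fun y => h.map_mem_range f y.1 y.2)
      map_id := fun U => by
        ext x
        exact congrArg (fun k => k.hom x.1) (F.cosheaf.map_id U)
      map_comp := fun f g => by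
        ext x
        exact congrArg (fun k => k.hom x.1) (F.cosheaf.map_comp f g) }
  isIso {V U} f := by
    rw [ConcreteCategory.isIso_iff_bijective]
    constructor
    · intro x y hxy
      exact Subtype.ext (h.injective f (congrArg Subtype.val hxy))
    · rintro ⟨_, x, rfl⟩
      exact ⟨⟨_, ⟨(F.sheaf.map f.op).hom x, rfl⟩⟩,
        Subtype.ext (congrArg (fun k => k.hom x) (F.comm f))⟩

end BisheafOn
end Sheaves

section Constructions

namespace Bisheaf

variable {X : Type u} [TopologicalSpace X] {V : Type v}

/-- The values of a bisheaf on non-empty connected open sets. -/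
def onConn (F : Bisheaf.{u, w} X) : BisheafOn.{u, w} (ConnOpens X) where
  sheaf := (Subtype.mono_coe fun U : Opens X => IsConnected (U : Set X)).functor.op ⋙ F.sheaf
  cosheaf := (Subtype.mono_coe fun U : Opens X => IsConnected (U : Set X)).functor ⋙ F.cosheaf
  map U := F.map U
  comm f := F.comm ((Subtype.mono_coe fun U : Opens X => IsConnected (U : Set X)).functor.map f)

/-- A bisheaf is constructible with respect to a triangulation if its sheaf and its cosheaf send
inclusions of basic open sets associated to a common stratum to isomorphisms. -/
def IsConstructible (F : Bisheaf.{u, w} X) (T : Triangulation X V) : Prop :=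
  ∀ (σ : Finset V) (U' U : Opens X), T.IsBasicAt T.K openSimplex σ U' →
    T.IsBasicAt T.K openSimplex σ U → ∀ f : U' ⟶ U,
      IsIso (F.sheaf.map f.op) ∧ IsIso (F.cosheaf.map f)

/-- The values of a bisheaf on the basic open sets of a triangulation. -/
def onBasic (F : Bisheaf.{u, w} X) (T : Triangulation X V) :
    BisheafOn.{u, w} {U : Opens X // T.IsBasic U} :=
  F.onConn.pullback
    { toFun := fun U => ⟨U.1, U.2.isConnected⟩
      monotone' := fun _ _ h => h }

/-- The pull-back `Σ^* F` of a bisheaf along the dilation map, given on basic open sets `U` of the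
second subdivision by `Σ^* F (U) = F (st Σ(C))` where `U` is associated to the simplex `C`. -/
def dilate (F : Bisheaf.{u, w} X) (T : Triangulation X V) :
    BisheafOn.{u, w} {U : Opens X // T.IsDilationBasic U} :=
  F.onConn.pullback
    { toFun := fun U => ⟨⟨T.dilateSet U.1, U.2.isOpen⟩, U.2.isConnected⟩
      monotone' := fun _ _ h => Triangulation.dilateSet_mono h }

end Bisheaf

variable {M : Type u} [TopologicalSpace M] {A : Type u'} [TopologicalSpace A]

/-- Let `a : A → M` be an étale open and let `P` describe the basic open sets of a stratification of
`M`.  These are the basic open sets of the pulled-back stratification of `A` that lie in the open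
set `S` of `A`: the open sets that `a` maps homeomorphically onto a basic open set of `M`. -/
abbrev EtaleBasic (a : A → M) (ha : IsLocalHomeomorph a) (S : Set A) (P : Opens M → Prop) :
    Type u' :=
  {U : Opens A // (U : Set A) ⊆ S ∧ Set.InjOn a U ∧ P ⟨a '' U, ha.isOpenMap _ U.2⟩}

/-- The pull-back `a^* F` of a bisheaf along the étale open `a|S`: `(a^* F)(U) = F(a(U))`. -/
def BisheafOn.etalePullback {P : Opens M → Prop} (F : BisheafOn.{u, w} {U : Opens M // P U})
    (a : A → M) (ha : IsLocalHomeomorph a) (S : Set A) :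
    BisheafOn.{u', w} (EtaleBasic a ha S P) :=
  F.pullback
    { toFun := fun U => ⟨_, U.2.2.2⟩
      monotone' := fun _ _ h => Set.image_mono h }

/-- The linear extension of a map of vertices to barycentric coordinates. -/
noncomputable def linearExtension {V : Type v} {W : Type v'} (ψ : W → V) (x : W → ℝ) : V → ℝ :=
  fun v => ∑ᶠ (w : W) (_ : ψ w = v), x w

open Classical in
/-- The data `(L, ψ)` exhibits `a : A → M` as an étale open of the `m`-manifold `M` that is
constructible with respect to the triangulation `T`. -/
structure IsConstructibleEtale (m : ℕ) {V : Type v} {W : Type v'} (T : Triangulation M V)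
    (a : A → M) (L : Triangulation A W) (ψ : W → V) : Prop where
  isLocalHomeomorph : IsLocalHomeomorph a
  simplicial : ∀ s ∈ L.K, s.image ψ ∈ T.K
  comm : ∀ x, T.coord (a x) = linearExtension ψ (L.coord x)
  isFace : ∀ s ∈ L.K₀, ∃ t ∈ L.K, t ∉ L.K₀ ∧ s ⊆ t
  single : ∀ s ∈ L.K₀, s.card = m → ∃! t, t ∈ L.K ∧ t ∉ L.K₀ ∧ t.card = m + 1 ∧ s ⊆ t

/-- The étale map `μ` from the shrinking of `a` to `a`, on basic open sets. -/
def shrinkingMap {V : Type v} {W : Type v'} (T : Triangulation M V) (a : A → M)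
    (ha : IsLocalHomeomorph a) (L : Triangulation A W) :
    EtaleBasic a ha L.shrinking T.IsDilationBasic →o EtaleBasic a ha Set.univ T.IsBasic where
  toFun U := ⟨U.1, Set.subset_univ _, U.2.2.1, U.2.2.2.isBasic⟩
  monotone' _ _ h := h

end Constructions

end PersistentSheaf

/-!
Both persistent local systems are pulled back from the poset of strata of `A`. The bisheaves
`a^* F` and `ȧ^* Σ^* F` are pull-backs of one bisheaf on that poset, whose value at a stratum `σ` is
`F (st ψ(σ))`: the first along the map that sends a basic open set to its stratum, the second along
the map that sends a basic open set associated to the chain `C` to the least simplex occurring in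
`C`. Both maps have connected fibres and lift comparable pairs, so a compatible family of subgroups
upstairs descends, and therefore isofication commutes with pull-back along them. Finally the least
simplex is a face of the stratum that contains `C`, so the two maps are comparable, and a local
system has isomorphic pull-backs along comparable maps.
-/

namespace PersistentSheaf

section ConnectedQuotients

variable {B : Type v} {B' : Type v'} [Preorder B']

/-- A monotone map of posets with connected fibres along which comparable pairs lift. Presheaves on
`B` then have the same global sections as their pull-backs to `B'`, see
`IsConnectedQuotient.exists_section`. -/
structure IsConnectedQuotient [Preorder B] (p : B' →o B) : Prop where
  fibre : ∀ ⦃x y⦄, p x = p y → Relation.EqvGen (fun x y => x ≤ y ∧ p x = p y) x y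
  lift : ∀ ⦃b c⦄, b ≤ c → ∃ x y, x ≤ y ∧ p x = b ∧ p y = c

namespace IsConnectedQuotient

theorem of_galoisInsertion [PartialOrder B] {p : B' →o B} {i : B → B'} (h : GaloisInsertion p i) :
    IsConnectedQuotient p where
  fibre x y hxy := by
    have to_closure (z) : Relation.EqvGen (fun x y => x ≤ y ∧ p x = p y) z (i (p z)) :=
      .rel _ _ ⟨h.gc.le_u_l z, (h.l_u_eq _).symm⟩
    exact .trans _ _ _ (to_closure x) (hxy ▸ (to_closure y).symm)
  lift b c hbc := ⟨i b, i c, h.gc.monotone_u hbc, h.l_u_eq b, h.l_u_eq c⟩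

variable [Preorder B]

theorem surjective {p : B' →o B} (hp : IsConnectedQuotient p) : Function.Surjective p := fun b =>
  let ⟨x, _, _, hx, _⟩ := hp.lift (le_refl b)
  ⟨x, hx⟩

theorem comp {B'' : Type w} [Preorder B''] {q : B →o B''} {p : B' →o B}
    (hq : IsConnectedQuotient q) (hp : IsConnectedQuotient p) :
    IsConnectedQuotient (q.comp p) where
  fibre := by
    let r : B' → B' → Prop := fun x y => x ≤ y ∧ q (p x) = q (p y)
    have of_eq {x y} (h : p x = p y) : Relation.EqvGen r x y :=
      (hp.fibre h).mono fun _ _ h => ⟨h.1, congrArg q h.2⟩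
    have key {b c} (h : Relation.EqvGen (fun b c => b ≤ c ∧ q b = q c) b c) :
        ∀ x y, p x = b → p y = c → Relation.EqvGen r x y := by
      induction h with
      | rel b c h =>
        rintro x y rfl rfl
        obtain ⟨x', y', hle, hx, hy⟩ := hp.lift h.1
        refine .trans _ _ _ (of_eq hx.symm) (.trans _ _ _ (.rel _ _ ⟨hle, ?_⟩) (of_eq hy))
        rw [hx, hy, h.2]
      | refl b => exact fun x y hx hy => of_eq (hx.trans hy.symm)
      | symm b c _ ih => exact fun x y hx hy => (ih y x hy hx).symm
      | trans b c d _ _ ih₁ ih₂ =>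
        obtain ⟨z, hz⟩ := hp.surjective c
        exact fun x y hx hy => (ih₁ x z hx hz).trans _ _ _ (ih₂ z y hz hy)
    exact fun x y h => key (hq.fibre h) x y rfl rfl
  lift b d hbd := by
    obtain ⟨c, c', hc, rfl, rfl⟩ := hq.lift hbd
    obtain ⟨x, y, hxy, rfl, rfl⟩ := hp.lift hc
    exact ⟨x, y, hxy, rfl, rfl⟩

theorem exists_section {p : B' →o B} (hp : IsConnectedQuotient p) (P : Bᵒᵖ ⥤ Type w)
    {s : ∀ x, P.obj (op (p (unop x)))} (hs : s ∈ (p.monotone.functor.op ⋙ P).sections) :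
    ∃ t ∈ P.sections, ∀ x, t (op (p x)) = s (op x) := by
  let value (x : B') : Σ b, P.obj (op b) := ⟨p x, s (op x)⟩
  have value_eq {x y} (h : p x = p y) : value x = value y := by
    refine ((eq_equivalence.comap value).eqvGen_iff).1 ((hp.fibre h).mono fun x y hxy => ?_)
    have hmap : P.map (homOfLE (p.monotone hxy.1)).op (s (op y)) = s (op x) :=
      hs (homOfLE hxy.1).op
    suffices ∀ c, p x = c → ∀ (f : p x ⟶ c) (z : P.obj (op c)), P.map f.op z = s (op x) →
        (⟨p x, s (op x)⟩ : Σ b, P.obj (op b)) = ⟨c, z⟩ from this _ hxy.2 _ _ hmap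
    rintro _ rfl f z hz
    rw [← hz, Subsingleton.elim f (𝟙 _), op_id, P.map_id]
    rfl
  choose g hg using hp.surjective
  have hval (b) : ∃ z : P.obj (op b), value (g b) = ⟨b, z⟩ := by
    have hb := hg b
    generalize g b = x at hb ⊢
    subst hb
    exact ⟨_, rfl⟩
  choose t ht using hval
  have ht' (x) : t (p x) = s (op x) :=
    eq_of_heq (Sigma.mk.inj ((ht (p x)).symm.trans (value_eq (hg (p x))))).2
  refine ⟨fun b => t b.unop, ?_, ht'⟩
  rintro ⟨c⟩ ⟨b⟩ f
  obtain ⟨x, y, hxy, rfl, rfl⟩ := hp.lift f.unop.le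
  change P.map f (t (p y)) = t (p x)
  rw [ht', ht']
  exact hs (homOfLE hxy).op

end IsConnectedQuotient

end ConnectedQuotients

section Isofication

variable {B : Type v} [Preorder B] {B' : Type v'} [Preorder B']

namespace BisheafOn

theorem le_epiSubgroup {F : Bᵒᵖ ⥤ AddCommGrpCat.{w}} {E : ∀ U, AddSubgroup (F.obj U)}
    (hE : IsSubEpisheaf F E) (U : Bᵒᵖ) : E U ≤ epiSubgroup F U :=
  le_iSup (fun E : {E : ∀ U, AddSubgroup (F.obj U) // IsSubEpisheaf F E} => E.1 U) ⟨E, hE⟩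

theorem monoKernel_le {G : B ⥤ AddCommGrpCat.{w}} {N : ∀ U, AddSubgroup (G.obj U)}
    (hN : IsMonoKernel G N) (U : B) : monoKernel G U ≤ N U :=
  iInf_le (fun N : {N : ∀ U, AddSubgroup (G.obj U) // IsMonoKernel G N} => N.1 U) ⟨N, hN⟩

theorem epiSubgroup_le_comap {F F' : Bᵒᵖ ⥤ AddCommGrpCat.{w}} (α : F ⟶ F') (U : Bᵒᵖ) :
    epiSubgroup F U ≤ (epiSubgroup F' U).comap (α.app U).hom := by
  rw [← AddSubgroup.map_le_iff_le_comap]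
  refine le_epiSubgroup (E := fun U => (epiSubgroup F U).map (α.app U).hom) (fun U V f => ?_) U
  beta_reduce
  rw [← epiSubgroup_isSubEpisheaf F f, AddSubgroup.map_map, AddSubgroup.map_map,
    ← AddCommGrpCat.hom_comp, ← AddCommGrpCat.hom_comp, α.naturality]

theorem monoKernel_le_comap {G G' : B ⥤ AddCommGrpCat.{w}} (β : G ⟶ G') (U : B) :
    monoKernel G U ≤ (monoKernel G' U).comap (β.app U).hom := by
  refine monoKernel_le (N := fun U => (monoKernel G' U).comap (β.app U).hom) (fun V U f => ?_) U
  beta_reduce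
  rw [← monoKernel_isMonoKernel G' f, AddSubgroup.comap_comap, AddSubgroup.comap_comap,
    ← AddCommGrpCat.hom_comp, ← AddCommGrpCat.hom_comp, β.naturality]

/-- Epification as a functor, on natural transformations. -/
def epiMap {F F' : Bᵒᵖ ⥤ AddCommGrpCat.{w}} (α : F ⟶ F') : epi F ⟶ epi F' where
  app U := AddCommGrpCat.ofHom
    (((α.app U).hom.comp (epiSubgroup F U).subtype).codRestrict (epiSubgroup F' U) fun x =>
      epiSubgroup_le_comap α U x.2)
  naturality U V f := by
    ext x
    exact Subtype.ext (congrArg (fun k => k.hom x.1) (α.naturality f))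

/-- Monofication as a functor, on natural transformations. -/
def monoMap {G G' : B ⥤ AddCommGrpCat.{w}} (β : G ⟶ G') : mono G ⟶ mono G' where
  app U := AddCommGrpCat.ofHom
    (QuotientAddGroup.map _ _ (β.app U).hom (monoKernel_le_comap β U))
  naturality V U f := by
    ext ⟨x⟩
    exact congrArg (fun k => QuotientAddGroup.mk' (monoKernel G' U) (k.hom x)) (β.naturality f)

/-- Isomorphic presheaves have isomorphic epifications. -/
def epiIso {F F' : Bᵒᵖ ⥤ AddCommGrpCat.{w}} (α : F ≅ F') : epi F ≅ epi F' where
  hom := epiMap α.hom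
  inv := epiMap α.inv
  hom_inv_id := by
    ext U x
    exact Subtype.ext (congrArg (fun k => k.hom x.1) (α.hom_inv_id_app U))
  inv_hom_id := by
    ext U x
    exact Subtype.ext (congrArg (fun k => k.hom x.1) (α.inv_hom_id_app U))

/-- Isomorphic precosheaves have isomorphic monofications. -/
def monoIso {G G' : B ⥤ AddCommGrpCat.{w}} (β : G ≅ G') : mono G ≅ mono G' where
  hom := monoMap β.hom
  inv := monoMap β.inv
  hom_inv_id := by
    ext U ⟨x⟩
    exact congrArg (fun k => QuotientAddGroup.mk' (monoKernel G U) (k.hom x))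
      (β.hom_inv_id_app U)
  inv_hom_id := by
    ext U ⟨x⟩
    exact congrArg (fun k => QuotientAddGroup.mk' (monoKernel G' U) (k.hom x))
      (β.inv_hom_id_app U)

/-- The presheaf of subgroups of a presheaf of groups under direct images. Its global sections are
the sub-episheaves. -/
def subgroupImages (F : Bᵒᵖ ⥤ AddCommGrpCat.{w}) : Bᵒᵖ ⥤ Type w where
  obj U := AddSubgroup (F.obj U)
  map f := TypeCat.ofHom (AddSubgroup.map (F.map f).hom)
  map_id U := by
    ext E : 3
    simp [AddSubgroup.map_id]
  map_comp f g := by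
    ext E : 3
    simp [AddSubgroup.map_map]

/-- The presheaf of subgroups of a precosheaf of groups under preimages. Its global sections are
the kernels of quotient-monocosheaves. -/
def subgroupPreimages (G : B ⥤ AddCommGrpCat.{w}) : Bᵒᵖ ⥤ Type w where
  obj U := AddSubgroup (G.obj (unop U))
  map f := TypeCat.ofHom (AddSubgroup.comap (G.map f.unop).hom)
  map_id U := by ext; simp
  map_comp f g := by ext; simp

/-- Quotients of an abelian group by equal subgroups are isomorphic. -/
def quotientIsoOfEq {X : AddCommGrpCat.{w}} {N N' : AddSubgroup X} (h : N = N') :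
    AddCommGrpCat.of (X ⧸ N) ≅ AddCommGrpCat.of (X ⧸ N') :=
  (QuotientAddGroup.quotientAddEquivOfEq h).toAddCommGrpIso

variable {p : B' →o B}

theorem epiSubgroup_pullback (hp : IsConnectedQuotient p) (F : Bᵒᵖ ⥤ AddCommGrpCat.{w}) (U : B') :
    epiSubgroup (p.monotone.functor.op ⋙ F) (op U) = epiSubgroup F (op (p U)) := by
  apply le_antisymm
  · obtain ⟨E, hE, hEp⟩ := hp.exists_section (subgroupImages F)
      (s := epiSubgroup (p.monotone.functor.op ⋙ F))
      (fun f => epiSubgroup_isSubEpisheaf (p.monotone.functor.op ⋙ F) f)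
    rw [← hEp]
    exact le_epiSubgroup (fun _ _ f => hE f) _
  · exact le_epiSubgroup (F := p.monotone.functor.op ⋙ F)
      (E := fun U => epiSubgroup F (op (p (unop U))))
      (fun _ _ f => epiSubgroup_isSubEpisheaf F (p.monotone.functor.op.map f)) _

theorem monoKernel_pullback (hp : IsConnectedQuotient p) (G : B ⥤ AddCommGrpCat.{w}) (U : B') :
    monoKernel (p.monotone.functor ⋙ G) U = monoKernel G (p U) := by
  apply le_antisymm
  · exact monoKernel_le (G := p.monotone.functor ⋙ G) (N := fun U => monoKernel G (p U))
      (fun _ _ f => monoKernel_isMonoKernel G (p.monotone.functor.map f)) _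
  · obtain ⟨N, hN, hNp⟩ := hp.exists_section (subgroupPreimages G)
      (s := fun U => monoKernel (p.monotone.functor ⋙ G) (unop U))
      (fun f => monoKernel_isMonoKernel (p.monotone.functor ⋙ G) f.unop)
    rw [← hNp]
    exact monoKernel_le (fun _ _ f => hN f.op) _

/-- Epification commutes with pull-back along a connected quotient. -/
def epiPullback (hp : IsConnectedQuotient p) (F : Bᵒᵖ ⥤ AddCommGrpCat.{w}) :
    epi (p.monotone.functor.op ⋙ F) ≅ p.monotone.functor.op ⋙ epi F :=
  NatIso.ofComponents
    fun U => (AddEquiv.addSubgroupCongr (epiSubgroup_pullback hp F (unop U))).toAddCommGrpIso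

/-- Monofication commutes with pull-back along a connected quotient. -/
def monoPullback (hp : IsConnectedQuotient p) (G : B ⥤ AddCommGrpCat.{w}) :
    mono (p.monotone.functor ⋙ G) ≅ p.monotone.functor ⋙ mono G :=
  NatIso.ofComponents
    (fun U => quotientIsoOfEq (X := G.obj (p U)) (monoKernel_pullback hp G U))
    fun f => by ext ⟨x⟩; rfl

/-- An isomorphism of bisheaves. -/
structure Isomorphism (F G : BisheafOn.{v, w} B) where
  /-- the isomorphism of sheaves -/
  sheaf : F.sheaf ≅ G.sheaf
  /-- the isomorphism of cosheaves -/
  cosheaf : F.cosheaf ≅ G.cosheaf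
  comm : ∀ U, sheaf.hom.app (op U) ≫ G.map U = F.map U ≫ cosheaf.hom.app U

namespace Isomorphism

variable {F G H : BisheafOn.{v, w} B}

/-- The inverse of an isomorphism of bisheaves. -/
def symm (e : Isomorphism F G) : Isomorphism G F where
  sheaf := e.sheaf.symm
  cosheaf := e.cosheaf.symm
  comm U := by
    rw [← cancel_epi (e.sheaf.hom.app (op U)), ← cancel_mono (e.cosheaf.hom.app U)]
    simp [e.comm]

/-- Composition of isomorphisms of bisheaves. -/
def trans (e : Isomorphism F G) (e' : Isomorphism G H) : Isomorphism F H where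
  sheaf := e.sheaf ≪≫ e'.sheaf
  cosheaf := e.cosheaf ≪≫ e'.cosheaf
  comm U := by
    simp only [Iso.trans_hom, NatTrans.comp_app, Category.assoc, e'.comm, reassoc_of% e.comm]

/-- Pull-back of an isomorphism of bisheaves. -/
def pullback (e : Isomorphism F G) (p : B' →o B) : Isomorphism (F.pullback p) (G.pullback p) where
  sheaf := Functor.isoWhiskerLeft _ e.sheaf
  cosheaf := Functor.isoWhiskerLeft _ e.cosheaf
  comm U := e.comm (p U)

/-- Isomorphic bisheaves have isomorphic isofications. -/
def iso (e : Isomorphism F G) : Isomorphism F.iso G.iso where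
  sheaf := epiIso e.sheaf
  cosheaf := monoIso e.cosheaf
  comm U := by
    ext x
    exact congrArg (fun k => QuotientAddGroup.mk' (monoKernel G.cosheaf U) (k.hom x.1)) (e.comm U)

/-- Isofication commutes with pull-back along a connected quotient. -/
def isoPullback (hp : IsConnectedQuotient p) (H : BisheafOn.{v, w} B) :
    Isomorphism (H.pullback p).iso (H.iso.pullback p) where
  sheaf := epiPullback hp H.sheaf
  cosheaf := monoPullback hp H.cosheaf
  comm _ := rfl

theorem map_mem_range (e : Isomorphism F G) {U : B} {y : F.cosheaf.obj U}
    (hy : y ∈ (F.map U).hom.range) : (e.cosheaf.hom.app U).hom y ∈ (G.map U).hom.range := by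
  obtain ⟨x, rfl⟩ := hy
  exact ⟨(e.sheaf.hom.app (op U)).hom x, congrArg (fun k => k.hom x) (e.comm U)⟩

/-- Isomorphic isobisheaves have isomorphic images. -/
def image (e : Isomorphism F G) (hF : F.IsIsobisheaf) (hG : G.IsIsobisheaf) :
    (F.image hF).functor ≅ (G.image hG).functor :=
  NatIso.ofComponents
    (fun U => {
      hom := AddCommGrpCat.ofHom (((e.cosheaf.hom.app U).hom.comp
        (F.map U).hom.range.subtype).codRestrict (G.map U).hom.range
          fun y => e.map_mem_range y.2)
      inv := AddCommGrpCat.ofHom (((e.cosheaf.inv.app U).hom.comp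
        (G.map U).hom.range.subtype).codRestrict (F.map U).hom.range
          fun y => e.symm.map_mem_range y.2)
      hom_inv_id := by
        ext y
        exact Subtype.ext (congrArg (fun k => k.hom y.1) (e.cosheaf.hom_inv_id_app U))
      inv_hom_id := by
        ext y
        exact Subtype.ext (congrArg (fun k => k.hom y.1) (e.cosheaf.inv_hom_id_app U)) })
    fun f => by
      ext y
      exact Subtype.ext (congrArg (fun k => k.hom y.1) (e.cosheaf.hom.naturality f))

end Isomorphism

end BisheafOn

end Isofication

section Comparison

variable {B : Type v} [Preorder B] {B' : Type v'} [Preorder B'] {p q : B' →o B}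

/-- The natural transformation between comparable monotone maps. -/
def transOfLE (h : p ≤ q) : p.monotone.functor ⟶ q.monotone.functor :=
  OrderHom.equivalenceFunctor.functor.map (homOfLE h)

/-- Pull-backs of a local system along comparable maps are isomorphic. -/
noncomputable def LocalSystem.isoOfLE (S : LocalSystem.{v, w} B) (h : p ≤ q) :
    p.monotone.functor ⋙ S.functor ≅ q.monotone.functor ⋙ S.functor :=
  haveI : IsIso (Functor.whiskerRight (transOfLE h) S.functor) :=
    (NatTrans.isIso_iff_isIso_app _).2 fun x => S.isIso ((transOfLE h).app x)
  asIso (Functor.whiskerRight (transOfLE h) S.functor)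

/-- Pull-backs of a bisheaf along comparable maps `p ≤ q` are isomorphic if the bisheaf sends each
inclusion `p x ≤ q x` to isomorphisms. -/
noncomputable def BisheafOn.Isomorphism.ofLE (F : BisheafOn.{v, w} B) (h : p ≤ q)
    (hF : ∀ x, IsIso (F.sheaf.map (homOfLE (h x)).op) ∧ IsIso (F.cosheaf.map (homOfLE (h x)))) :
    Isomorphism (F.pullback p) (F.pullback q) :=
  haveI : IsIso (Functor.whiskerRight (NatTrans.op (transOfLE h)) F.sheaf) :=
    (NatTrans.isIso_iff_isIso_app _).2 fun x => (hF (unop x)).1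
  haveI : IsIso (Functor.whiskerRight (transOfLE h) F.cosheaf) :=
    (NatTrans.isIso_iff_isIso_app _).2 fun x => (hF x).2
  let sheafIso := asIso (Functor.whiskerRight (NatTrans.op (transOfLE h)) F.sheaf)
  let cosheafIso := asIso (Functor.whiskerRight (transOfLE h) F.cosheaf)
  { sheaf := sheafIso.symm
    cosheaf := cosheafIso
    comm x := (Iso.inv_comp_eq (sheafIso.app (op x))).2 (F.comm ((transOfLE h).app x)).symm }

/-- A constructible bisheaf does not distinguish between basic open sets `g x ⊆ h (p x)` associated
to a common simplex. -/
noncomputable def Bisheaf.IsConstructible.isomorphism {M : Type u} [TopologicalSpace M]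
    {V : Type*} {F : Bisheaf.{u, w} M} {T : Triangulation M V} (hF : F.IsConstructible T)
    {g : B' →o ConnOpens M} {h : B →o ConnOpens M} {p : B' →o B} (hle : g ≤ h.comp p)
    (hbasic : ∀ x, ∃ σ, T.IsBasicAt T.K openSimplex σ (g x).1 ∧
      T.IsBasicAt T.K openSimplex σ (h (p x)).1) :
    BisheafOn.Isomorphism (F.onConn.pullback g) ((F.onConn.pullback h).pullback p) :=
  .ofLE F.onConn hle fun x =>
    let ⟨σ, hg, hh⟩ := hbasic x
    hF σ _ _ hg hh _

end Comparison

section Chains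

variable {V : Type v} {K K₀ : PreAbstractSimplicialComplex V} {c : Finset (Finset V)}
  {C D : Finset (Finset (Finset V))} {σ : Finset V}

theorem dilationVertex_mem_of_mem_sd (hc : c ∈ sd K) : dilationVertex c ∈ c :=
  (dilationVertex_mem hc.1 hc.2.2).1

theorem dilationVertex_subset (hc : c ∈ sd K) (hσ : σ ∈ c) : dilationVertex c ⊆ σ :=
  (dilationVertex_mem hc.1 hc.2.2).2 σ hσ

theorem dilationVertex_eq (hc : c ∈ sd K) (hσ : σ ∈ c) (hle : ∀ τ ∈ c, σ ⊆ τ) :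
    dilationVertex c = σ :=
  (dilationVertex_subset hc hσ).antisymm (hle _ (dilationVertex_mem_of_mem_sd hc))

theorem singleton_mem_sd (hσ : σ ∈ K) : {σ} ∈ sd K :=
  ⟨Finset.singleton_nonempty σ, by simpa using hσ, by simp⟩

theorem insert_mem_sd [DecidableEq (Finset V)] (hc : c ∈ sd K) (hσ : σ ∈ K)
    (hle : ∀ τ ∈ c, σ ⊆ τ) : insert σ c ∈ sd K := by
  refine ⟨Finset.insert_nonempty σ c, Finset.forall_mem_insert .. |>.2 ⟨hσ, hc.2.1⟩, ?_⟩
  rw [Finset.coe_insert]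
  exact hc.2.2.insert fun τ hτ _ => Or.inl (hle τ hτ)

theorem dilationVertex_singleton (hσ : σ ∈ K) : dilationVertex {σ} = σ :=
  dilationVertex_eq (singleton_mem_sd hσ) (by simp) (by simp)

theorem dilationVertex_insert [DecidableEq (Finset V)] (hc : c ∈ sd K) (hσ : σ ∈ K)
    (hle : ∀ τ ∈ c, σ ⊆ τ) : dilationVertex (insert σ c) = σ :=
  dilationVertex_eq (insert_mem_sd hc hσ hle) (Finset.mem_insert_self σ c)
    (Finset.forall_mem_insert .. |>.2 ⟨subset_rfl, hle⟩)

/-- The least simplex of the least chain of a simplex `C` of the second subdivision. It is the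
largest vertex of `dilation C`, and an open simplex in the second subdivision of a simplicial pair
`(K, K₀)` lies in the shrinking if and only if its `lowest` simplex is not in `K₀`. -/
noncomputable def lowest (C : Finset (Finset (Finset V))) : Finset V :=
  dilationVertex (dilationVertex C)

theorem dilationVertex_mem_sd (hC : C ∈ sd (sd K)) : dilationVertex C ∈ sd K :=
  hC.2.1 _ (dilationVertex_mem_of_mem_sd hC)

theorem lowest_mem_dilationVertex (hC : C ∈ sd (sd K)) : lowest C ∈ dilationVertex C :=
  dilationVertex_mem_of_mem_sd (dilationVertex_mem_sd hC)

theorem lowest_mem_of_mem (hC : C ∈ sd (sd K)) (hc : c ∈ C) : lowest C ∈ c :=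
  dilationVertex_subset hC hc (lowest_mem_dilationVertex hC)

theorem lowest_mem (hC : C ∈ sd (sd K)) : lowest C ∈ K :=
  (dilationVertex_mem_sd hC).2.1 _ (lowest_mem_dilationVertex hC)

theorem insert_singleton_lowest_mem_sd [DecidableEq (Finset (Finset V))] (hC : C ∈ sd (sd K)) :
    insert {lowest C} C ∈ sd (sd K) :=
  insert_mem_sd hC (singleton_mem_sd (lowest_mem hC)) fun _ hc =>
    Finset.singleton_subset_iff.2 (lowest_mem_of_mem hC hc)

theorem lowest_insert_singleton_lowest [DecidableEq (Finset (Finset V))] (hC : C ∈ sd (sd K)) :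
    lowest (insert {lowest C} C) = lowest C := by
  have hle (c) (hc : c ∈ C) : {lowest C} ⊆ c :=
    Finset.singleton_subset_iff.2 (lowest_mem_of_mem hC hc)
  rw [lowest, dilationVertex_insert hC (singleton_mem_sd (lowest_mem hC)) hle,
    dilationVertex_singleton (lowest_mem hC)]

theorem lowest_singleton_singleton (hσ : σ ∈ K) : lowest {{σ}} = σ := by
  rw [lowest, dilationVertex_singleton (singleton_mem_sd hσ), dilationVertex_singleton hσ]

theorem subset_lowest_of_mem_dilation (hC : C ∈ sd (sd K)) (hσ : σ ∈ dilation C) :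
    σ ⊆ lowest C := by
  classical
  obtain ⟨c, hc, rfl⟩ := Finset.mem_image.1 hσ
  exact dilationVertex_subset (hC.2.1 c hc) (lowest_mem_of_mem hC hc)

theorem lowest_mem_dilation (hC : C ∈ sd (sd K)) : lowest C ∈ dilation C := by
  classical
  exact Finset.mem_image_of_mem _ (dilationVertex_mem_of_mem_sd hC)

theorem lowest_mono (hC : C ∈ sd (sd K)) (hD : D ∈ sd (sd K)) (h : C ⊆ D) :
    lowest C ⊆ lowest D := by
  classical
  exact subset_lowest_of_mem_dilation hD (Finset.image_subset_image h (lowest_mem_dilation hC))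

theorem dilation_mem_sd_iff (hC : C ∈ sd (sd K)) : dilation C ∈ sd K₀ ↔ lowest C ∈ K₀ := by
  refine ⟨fun h => h.2.1 _ (lowest_mem_dilation hC), fun h => ?_⟩
  have hd := dilation_mem hC
  exact ⟨hd.1, fun σ hσ => (K₀.isRelLowerSet_faces h).2 (subset_lowest_of_mem_dilation hC hσ)
    (mem_nonempty (hd.2.1 σ hσ)), hd.2.2⟩

theorem mem_closedStar_iff (hC : C ∈ sd (sd K)) :
    C ∈ closedStar (sd (sd K)) (sd (sd K₀)) ↔ lowest C ∈ K₀ := by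
  classical
  constructor
  · rintro ⟨-, D, hD, hCD, R, hR, hRD⟩
    obtain ⟨r, hr⟩ := hR.1
    have hD₀ : lowest D ∈ K₀ := (hR.2.1 r hr).2.1 _ (lowest_mem_of_mem hD (hRD hr))
    exact (K₀.isRelLowerSet_faces hD₀).2 (lowest_mono hC hD hCD) (mem_nonempty (lowest_mem hC))
  · intro h
    exact ⟨hC, insert {lowest C} C, insert_singleton_lowest_mem_sd hC,
      Finset.subset_insert _ _, {{lowest C}}, singleton_mem_sd (singleton_mem_sd h), by simp⟩

end Chains

section Push

variable {V : Type v} {W : Type v'}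

open Classical in
/-- The map of simplices induced by a map of vertices. -/
noncomputable def push (f : W → V) (s : Finset W) : Finset V := s.image f

variable {f : W → V} {K : PreAbstractSimplicialComplex W} {K' : PreAbstractSimplicialComplex V}

theorem mem_push {s : Finset W} {v : V} : v ∈ push f s ↔ ∃ w ∈ s, f w = v := by
  simp [push]

open Classical in
theorem push_nonempty {s : Finset W} (h : s.Nonempty) : (push f s).Nonempty := h.image f

theorem push_mono {s t : Finset W} (h : s ⊆ t) : push f s ⊆ push f t := by
  classical
  exact Finset.image_subset_image h

theorem push_mem_sd (hf : ∀ s ∈ K, push f s ∈ K') {c : Finset (Finset W)} (hc : c ∈ sd K) :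
    push (push f) c ∈ sd K' := by
  refine ⟨push_nonempty hc.1, fun σ hσ => ?_, ?_⟩
  · obtain ⟨τ, hτ, rfl⟩ := mem_push.1 hσ
    exact hf τ (hc.2.1 τ hτ)
  · intro σ hσ τ hτ _
    obtain ⟨σ', hσ', rfl⟩ := mem_push.1 hσ
    obtain ⟨τ', hτ', rfl⟩ := mem_push.1 hτ
    exact (hc.2.2.total hσ' hτ').imp push_mono push_mono

theorem dilationVertex_push (hf : ∀ s ∈ K, push f s ∈ K') {c : Finset (Finset W)}
    (hc : c ∈ sd K) : dilationVertex (push (push f) c) = push f (dilationVertex c) := by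
  refine dilationVertex_eq (push_mem_sd hf hc)
    (mem_push.2 ⟨_, dilationVertex_mem_of_mem_sd hc, rfl⟩) fun τ hτ => ?_
  obtain ⟨σ, hσ, rfl⟩ := mem_push.1 hτ
  exact push_mono (dilationVertex_subset hc hσ)

theorem lowest_push (hf : ∀ s ∈ K, push f s ∈ K') {D : Finset (Finset (Finset W))}
    (hD : D ∈ sd (sd K)) : lowest (push (push (push f)) D) = push f (lowest D) := by
  rw [lowest, dilationVertex_push (fun _ => push_mem_sd hf) hD,
    dilationVertex_push hf (dilationVertex_mem_sd hD), lowest]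

end Push

section Strata

variable {V : Type v}

namespace SimplicialPair

/-- The simplices of `K - K₀`, ordered by reverse inclusion, that is, by inclusion of their open
stars. -/
abbrev Stratum (P : SimplicialPair V) : Type v := {s // s ∈ P.K ∧ s ∉ P.K₀}ᵒᵈ

/-- The simplices of `K² - cl st K₀²`, ordered by reverse inclusion. -/
abbrev ShrinkingStratum (P : SimplicialPair V) : Type v :=
  {C // C ∈ sd (sd P.K) ∧ lowest C ∉ P.K₀}ᵒᵈ

variable {P : SimplicialPair V}

theorem Stratum.mem (s : P.Stratum) : s.ofDual.1 ∈ P.K := s.ofDual.2.1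

theorem Stratum.notMem (s : P.Stratum) : s.ofDual.1 ∉ P.K₀ := s.ofDual.2.2

theorem ShrinkingStratum.mem (C : P.ShrinkingStratum) : C.ofDual.1 ∈ sd (sd P.K) := C.ofDual.2.1

theorem ShrinkingStratum.notMem (C : P.ShrinkingStratum) : lowest C.ofDual.1 ∉ P.K₀ :=
  C.ofDual.2.2

theorem Stratum.le_iff {s t : P.Stratum} : s ≤ t ↔ t.ofDual.1 ⊆ s.ofDual.1 := Iff.rfl

theorem ShrinkingStratum.le_iff {C D : P.ShrinkingStratum} :
    C ≤ D ↔ D.ofDual.1 ⊆ C.ofDual.1 := Iff.rfl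

variable (P) in
/-- The map of strata under the dilation, `C ↦ lowest C`. -/
noncomputable def lowestHom : P.ShrinkingStratum →o P.Stratum where
  toFun C := .toDual ⟨lowest C.ofDual.1, lowest_mem C.mem, C.notMem⟩
  monotone' C D h := Stratum.le_iff.2 <|
    lowest_mono D.mem C.mem (ShrinkingStratum.le_iff.1 h)

theorem ofDual_lowestHom (C : P.ShrinkingStratum) :
    (P.lowestHom C).ofDual.1 = lowest C.ofDual.1 := rfl

theorem lowestHom_eq_iff {C : P.ShrinkingStratum} {s : P.Stratum} :
    P.lowestHom C = s ↔ lowest C.ofDual.1 = s.ofDual.1 := by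
  rw [← OrderDual.ofDual_inj, Subtype.ext_iff, ofDual_lowestHom]

/-- The vertex of the second subdivision at a simplex of `K`. -/
def vertexStratum (s : P.Stratum) : P.ShrinkingStratum :=
  .toDual ⟨{{s.ofDual.1}}, singleton_mem_sd (singleton_mem_sd s.mem), by
    rw [lowest_singleton_singleton s.mem]
    exact s.notMem⟩

theorem lowestHom_vertexStratum (s : P.Stratum) : P.lowestHom (vertexStratum s) = s :=
  lowestHom_eq_iff.2 (lowest_singleton_singleton s.mem)

theorem exists_le_le_vertexStratum {C : P.ShrinkingStratum} {s : P.Stratum}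
    (h : P.lowestHom C = s) : ∃ C' ≤ C, C' ≤ vertexStratum s ∧ P.lowestHom C' = s := by
  classical
  replace h : lowest C.ofDual.1 = s.ofDual.1 := lowestHom_eq_iff.1 h
  have hlow : lowest (insert {s.ofDual.1} C.ofDual.1) = s.ofDual.1 := by
    rw [← h, lowest_insert_singleton_lowest C.mem]
  refine ⟨.toDual ⟨_, h ▸ insert_singleton_lowest_mem_sd C.mem, ?_⟩, ?_, ?_, ?_⟩
  · rw [hlow]
    exact s.notMem
  · exact ShrinkingStratum.le_iff.2 (Finset.subset_insert _ _)
  · exact ShrinkingStratum.le_iff.2 (Finset.singleton_subset_iff.2 (Finset.mem_insert_self _ _))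
  · exact lowestHom_eq_iff.2 hlow

theorem exists_le_lowestHom_eq {s t : P.Stratum} (hst : s ≤ t) :
    ∃ C D, C ≤ D ∧ P.lowestHom C = s ∧ P.lowestHom D = t := by
  classical
  obtain ⟨⟨s, hs, hs₀⟩, rfl⟩ := OrderDual.toDual.surjective s
  obtain ⟨⟨t, ht, ht₀⟩, rfl⟩ := OrderDual.toDual.surjective t
  replace hst : t ⊆ s := Stratum.le_iff.1 hst
  have hedge : {t, s} ∈ sd P.K := insert_mem_sd (singleton_mem_sd hs) ht (by simpa using hst)
  have hflag : {{s}, {t, s}} ∈ sd (sd P.K) :=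
    insert_mem_sd (singleton_mem_sd hedge) (singleton_mem_sd hs) (by simp)
  have hD : lowest {{t, s}} = t := by
    rw [lowest, dilationVertex_singleton hedge,
      dilationVertex_insert (singleton_mem_sd hs) ht (by simpa using hst)]
  have hC : lowest {{s}, {t, s}} = s := by
    rw [lowest, dilationVertex_insert (singleton_mem_sd hedge) (singleton_mem_sd hs) (by simp),
      dilationVertex_singleton hs]
  have hCD : ({{t, s}} : Finset (Finset (Finset V))) ⊆ {{s}, {t, s}} := Finset.subset_insert _ _
  refine ⟨.toDual ⟨_, hflag, ?_⟩, .toDual ⟨_, singleton_mem_sd hedge, ?_⟩,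
    ShrinkingStratum.le_iff.2 hCD, lowestHom_eq_iff.2 hC, lowestHom_eq_iff.2 hD⟩
  · rwa [hC]
  · rwa [hD]

theorem isConnectedQuotient_lowestHom : IsConnectedQuotient P.lowestHom where
  fibre C D h := by
    have to_vertex {C : P.ShrinkingStratum} {s : P.Stratum} (hC : P.lowestHom C = s) :
        Relation.EqvGen (fun C D => C ≤ D ∧ P.lowestHom C = P.lowestHom D) C (vertexStratum s) := by
      obtain ⟨C', hC', hvertex, heq⟩ := exists_le_le_vertexStratum hC
      exact .trans _ C' _ (.symm _ _ (.rel _ _ ⟨hC', heq.trans hC.symm⟩))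
        (.rel _ _ ⟨hvertex, heq.trans (lowestHom_vertexStratum _).symm⟩)
    exact .trans _ _ _ (to_vertex h) (to_vertex rfl).symm
  lift _ _ := exists_le_lowestHom_eq

end SimplicialPair

end Strata

section OpenSimplices

variable {V : Type v} {s t : Finset V} {x y : V → ℝ}

theorem nonneg_of_mem_openSimplex (hx : x ∈ openSimplex s) (v : V) : 0 ≤ x v := by
  by_cases hv : v ∈ s
  exacts [(hx.1 v hv).le, (hx.2.1 v hv).ge]

theorem mem_iff_pos_of_mem_openSimplex (hx : x ∈ openSimplex s) {v : V} : v ∈ s ↔ 0 < x v :=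
  ⟨hx.1 v, fun hv => by_contra fun hvs => hv.ne' (hx.2.1 v hvs)⟩

theorem sum_eq_one_of_mem_openSimplex (hx : x ∈ openSimplex s) (hst : s ⊆ t) :
    ∑ v ∈ t, x v = 1 :=
  (Finset.sum_subset hst fun v _ hv => hx.2.1 v hv).symm.trans hx.2.2

theorem openSimplex_nonempty (hs : s.Nonempty) : (openSimplex s).Nonempty := by
  classical
  have hcard : 0 < (s.card : ℝ) := Nat.cast_pos.2 hs.card_pos
  refine ⟨fun v => if v ∈ s then (s.card : ℝ)⁻¹ else 0, fun v hv => ?_, fun v hv => if_neg hv, ?_⟩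
  · simp only [if_pos hv]
    exact inv_pos.2 hcard
  · rw [Finset.sum_congr rfl fun v hv => if_pos hv, Finset.sum_const, nsmul_eq_mul,
      mul_inv_cancel₀ hcard.ne']

theorem add_smul_mem_openSimplex (hst : s ⊆ t) (hx : x ∈ openSimplex s) (hy : y ∈ openSimplex t)
    {a b : ℝ} (ha : 0 ≤ a) (hb : 0 < b) (hab : a + b = 1) : a • x + b • y ∈ openSimplex t := by
  refine ⟨fun v hv => ?_, fun v hv => ?_, ?_⟩
  · exact add_pos_of_nonneg_of_pos (mul_nonneg ha (nonneg_of_mem_openSimplex hx v))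
      (mul_pos hb (hy.1 v hv))
  · simp [hx.2.1 v (mt (@hst v) hv), hy.2.1 v hv]
  · simp [Finset.sum_add_distrib, ← Finset.mul_sum, sum_eq_one_of_mem_openSimplex hx hst, hy.2.2,
      hab]

/- Both `x` and `y` have total mass one, so the mass that `y` has outside `s` is the mass that it
lacks on `s`. -/
theorem sum_abs_sub_le (hx : x ∈ openSimplex s) (hy : y ∈ openSimplex t) (r : Finset V) :
    ∑ v ∈ r, |y v - x v| ≤ 2 * ∑ v ∈ s, |y v - x v| := by
  classical
  have houtside : ∑ v ∈ t \ s, |y v - x v| = ∑ v ∈ s, (x v - y v) := by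
    have hmass : ∑ v ∈ t \ s, y v + ∑ v ∈ s, y v = 1 := by
      rw [← Finset.sum_union Finset.sdiff_disjoint, Finset.sdiff_union_self_eq_union]
      exact sum_eq_one_of_mem_openSimplex hy Finset.subset_union_left
    rw [Finset.sum_sub_distrib, hx.2.2, ← hmass, add_sub_cancel_right]
    refine Finset.sum_congr rfl fun v hv => ?_
    rw [hx.2.1 v (Finset.mem_sdiff.1 hv).2, sub_zero,
      abs_of_nonneg (nonneg_of_mem_openSimplex hy v)]
  have hzero (v) (_ : v ∈ r ∪ (t ∪ s)) (hv : v ∉ t ∪ s) : |y v - x v| = 0 := by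
    rw [Finset.notMem_union] at hv
    rw [hx.2.1 v hv.2, hy.2.1 v hv.1, sub_zero, abs_zero]
  calc ∑ v ∈ r, |y v - x v| ≤ ∑ v ∈ r ∪ (t ∪ s), |y v - x v| :=
        Finset.sum_le_sum_of_subset_of_nonneg Finset.subset_union_left fun _ _ _ => abs_nonneg _
    _ = ∑ v ∈ t ∪ s, |y v - x v| := (Finset.sum_subset Finset.subset_union_right hzero).symm
    _ = ∑ v ∈ t \ s, |y v - x v| + ∑ v ∈ s, |y v - x v| := by
        rw [← Finset.sdiff_union_self_eq_union, Finset.sum_union Finset.sdiff_disjoint]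
    _ ≤ ∑ v ∈ s, |y v - x v| + ∑ v ∈ s, |y v - x v| := by
        rw [houtside]
        gcongr with v
        exact abs_sub_comm (y v) (x v) ▸ le_abs_self _
    _ = 2 * ∑ v ∈ s, |y v - x v| := (two_mul _).symm

end OpenSimplices

section Subdivision

variable {V : Type v} {K K₀ : PreAbstractSimplicialComplex V} {c d : Finset (Finset V)}
  {f g : Finset V → ℝ} {σ : Finset V}

theorem mem_sd_iff_of_top (hc : c ∈ sd K) (hσ : σ ∈ c) (htop : ∀ τ ∈ c, τ ⊆ σ) :
    c ∈ sd K₀ ↔ σ ∈ K₀ :=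
  ⟨fun h => h.2.1 σ hσ, fun h => ⟨hc.1, fun τ hτ => (K₀.isRelLowerSet_faces h).2 (htop τ hτ)
    (mem_nonempty (hc.2.1 τ hτ)), hc.2.2⟩⟩

theorem sdMap_eq_sum_filter [DecidableEq V] (hf : ∀ σ ∉ c, f σ = 0) (v : V) :
    sdMap f v = ∑ σ ∈ c with v ∈ σ, f σ / (σ.card : ℝ) := by
  rw [sdMap_apply hf, Finset.sum_filter]
  exact Finset.sum_congr rfl fun σ _ => by congr

theorem sdMap_add_smul (hf : ∀ σ ∉ c, f σ = 0) (hg : ∀ σ ∉ c, g σ = 0) (a b : ℝ) :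
    sdMap (a • f + b • g) = a • sdMap f + b • sdMap g := by
  classical
  funext v
  have hfg (σ) (hσ : σ ∉ c) : (a • f + b • g) σ = 0 := by simp [hf σ hσ, hg σ hσ]
  simp only [Pi.add_apply, Pi.smul_apply, smul_eq_mul, sdMap_eq_sum_filter hfg,
    sdMap_eq_sum_filter hf, sdMap_eq_sum_filter hg, Finset.mul_sum, ← Finset.sum_add_distrib,
    add_div, mul_div_assoc]

theorem abs_sdMap_sub_le [DecidableEq (Finset V)] (hf : f ∈ openSimplex c)
    (hg : g ∈ openSimplex d) (v : V) :
    |sdMap g v - sdMap f v| ≤ ∑ σ ∈ c ∪ d, |g σ - f σ| := by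
  classical
  have hf' (σ) (hσ : σ ∉ c ∪ d) : f σ = 0 := hf.2.1 σ fun h => hσ (Finset.mem_union_left d h)
  have hg' (σ) (hσ : σ ∉ c ∪ d) : g σ = 0 := hg.2.1 σ fun h => hσ (Finset.mem_union_right c h)
  rw [sdMap_eq_sum_filter hf', sdMap_eq_sum_filter hg', ← Finset.sum_sub_distrib]
  refine (Finset.abs_sum_le_sum_abs _ _).trans ?_
  refine (Finset.sum_le_sum fun σ hσ => ?_).trans
    (Finset.sum_le_sum_of_subset_of_nonneg (Finset.filter_subset _ _) fun _ _ _ => abs_nonneg _)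
  have hcard : 1 ≤ (σ.card : ℝ) := by
    exact_mod_cast Finset.card_pos.2 ⟨v, (Finset.mem_filter.1 hσ).2⟩
  rw [← sub_div, abs_div, abs_of_pos (zero_lt_one.trans_le hcard)]
  exact div_le_self (abs_nonneg _) hcard

theorem div_card_nonneg (hf : f ∈ openSimplex c) (σ : Finset V) : 0 ≤ f σ / (σ.card : ℝ) :=
  div_nonneg (nonneg_of_mem_openSimplex hf σ) (Nat.cast_nonneg _)

theorem div_card_le_sdMap (hf : f ∈ openSimplex c) (hσ : σ ∈ c) {v : V} (hv : v ∈ σ) :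
    f σ / (σ.card : ℝ) ≤ sdMap f v := by
  classical
  rw [sdMap_eq_sum_filter hf.2.1]
  exact Finset.single_le_sum (f := fun σ => f σ / (σ.card : ℝ))
    (fun τ _ => div_card_nonneg hf τ) (Finset.mem_filter.2 ⟨hσ, hv⟩)

theorem div_card_add_sdMap_le (hc : c ∈ sd K) (hf : f ∈ openSimplex c) (hσ : σ ∈ c) {v w : V}
    (hv : v ∈ σ) (hw : w ∉ σ) : f σ / (σ.card : ℝ) + sdMap f w ≤ sdMap f v := by
  classical
  simp only [sdMap_eq_sum_filter hf.2.1]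
  rw [← Finset.sum_insert (f := fun τ => f τ / (τ.card : ℝ)) (by simp [hw])]
  refine Finset.sum_le_sum_of_subset_of_nonneg (Finset.insert_subset ?_ fun τ hτ => ?_)
    fun τ _ _ => div_card_nonneg hf τ
  · exact Finset.mem_filter.2 ⟨hσ, hv⟩
  · obtain ⟨hτ, hwτ⟩ := Finset.mem_filter.1 hτ
    have hστ : σ ⊆ τ := (hc.2.2.total hσ hτ).resolve_right fun h => hw (h hwτ)
    exact Finset.mem_filter.2 ⟨hτ, hστ hv⟩

theorem exists_mem_forall_subset (hc : c ∈ sd K) (hσ : σ ∈ c) :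
    ∃ v ∈ σ, ∀ τ ∈ c, v ∈ τ → σ ⊆ τ := by
  classical
  rcases (c.filter (· ⊂ σ)).eq_empty_or_nonempty with hempty | hne
  · obtain ⟨v, hv⟩ := mem_nonempty (hc.2.1 σ hσ)
    refine ⟨v, hv, fun τ hτ _ => (hc.2.2.total hσ hτ).elim id fun h => ?_⟩
    exact (h.eq_of_not_ssubset (Finset.filter_eq_empty_iff.1 hempty hτ)).ge
  · obtain ⟨ρ, hρ, htop⟩ :=
      exists_top (((sd K).isRelLowerSet_faces hc).2 (Finset.filter_subset _ c) hne)
    obtain ⟨v, hv, hvρ⟩ := Finset.exists_of_ssubset (Finset.mem_filter.1 hρ).2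
    refine ⟨v, hv, fun τ hτ hvτ => (hc.2.2.total hσ hτ).elim id fun h => ?_⟩
    refine (h.eq_of_not_ssubset fun hlt => hvρ ?_).ge
    exact htop τ (Finset.mem_filter.2 ⟨hτ, hlt⟩) hvτ

theorem forall_not_ssubset_or_exists_notMem (hc : c ∈ sd K) (σ : Finset V) :
    (∀ τ ∈ c, ¬ σ ⊂ τ) ∨ ∃ w ∉ σ, ∀ τ ∈ c, σ ⊂ τ → w ∈ τ := by
  classical
  rcases (c.filter (σ ⊂ ·)).eq_empty_or_nonempty with hempty | hne
  · exact .inl fun τ hτ => Finset.filter_eq_empty_iff.1 hempty hτ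
  · have hfilter := ((sd K).isRelLowerSet_faces hc).2 (Finset.filter_subset (σ ⊂ ·) c) hne
    obtain ⟨w, hw, hwσ⟩ := Finset.exists_of_ssubset
      (Finset.mem_filter.1 (dilationVertex_mem_of_mem_sd hfilter)).2
    exact .inr ⟨w, hwσ, fun τ hτ hστ =>
      dilationVertex_subset hfilter (Finset.mem_filter.2 ⟨hτ, hστ⟩) hw⟩

theorem exists_sdMap_le_of_mem (hc : c ∈ sd K) (hf : f ∈ openSimplex c) (hσ : σ ∈ c) :
    ∃ v ∈ σ, sdMap f v ≤ f σ / (σ.card : ℝ) ∨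
      ∃ w ∉ σ, sdMap f v ≤ f σ / (σ.card : ℝ) + sdMap f w := by
  classical
  obtain ⟨v, hv, hmin⟩ := exists_mem_forall_subset hc hσ
  have hsum : sdMap f v = f σ / (σ.card : ℝ) + ∑ τ ∈ c with σ ⊂ τ, f τ / (τ.card : ℝ) := by
    rw [sdMap_eq_sum_filter hf.2.1,
      ← Finset.sum_insert (f := fun τ => f τ / (τ.card : ℝ)) (by simp)]
    congr 1
    ext τ
    rw [Finset.mem_insert, Finset.mem_filter, Finset.mem_filter]
    constructor
    · rintro ⟨hτ, hvτ⟩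
      exact (hmin τ hτ hvτ).eq_or_ssubset.imp Eq.symm fun h => ⟨hτ, h⟩
    · rintro (rfl | ⟨hτ, h⟩)
      exacts [⟨hσ, hv⟩, ⟨hτ, h.subset hv⟩]
  refine ⟨v, hv, (forall_not_ssubset_or_exists_notMem hc σ).imp (fun hmax => ?_) ?_⟩
  · rw [hsum, Finset.filter_eq_empty_iff.2 hmax, Finset.sum_empty, add_zero]
  · rintro ⟨w, hw, hmem⟩
    refine ⟨w, hw, ?_⟩
    rw [hsum, sdMap_eq_sum_filter hf.2.1 w]
    refine add_le_add le_rfl (Finset.sum_le_sum_of_subset_of_nonneg (fun τ hτ => ?_)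
      fun τ _ _ => div_card_nonneg hf τ)
    obtain ⟨hτ, hστ⟩ := Finset.mem_filter.1 hτ
    exact Finset.mem_filter.2 ⟨hτ, hmem τ hτ hστ⟩

theorem exists_sdMap_le (hc : c ∈ sd K) (hf : f ∈ openSimplex c) (hne : σ.Nonempty) :
    ∃ v ∈ σ, sdMap f v ≤ f σ / (σ.card : ℝ) ∨
      ∃ w ∉ σ, sdMap f v ≤ f σ / (σ.card : ℝ) + sdMap f w := by
  by_cases hσ : σ ∈ c
  · exact exists_sdMap_le_of_mem hc hf hσ
  · by_contra! hlt
    rw [hf.2.1 σ hσ, zero_div] at hlt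
    simp only [zero_add] at hlt
    exact hσ (mem_of_lt_of_mem_cell₁ hc ⟨f, hf, rfl⟩ hne hlt)

/- The weight of `σ` divided by its cardinality is the gap between the least coordinate of `sdMap f`
at a vertex of `σ` and the greatest one outside `σ`, hence controlled by the coordinates. -/
theorem div_card_le_add (hc : c ∈ sd K) (hd : d ∈ sd K) (hf : f ∈ openSimplex c)
    (hg : g ∈ openSimplex d) {δ : ℝ} (hδ : ∀ v, |sdMap g v - sdMap f v| ≤ δ)
    (hne : σ.Nonempty) : g σ / (σ.card : ℝ) ≤ f σ / (σ.card : ℝ) + 2 * δ := by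
  have hδ₀ : 0 ≤ δ := (abs_nonneg _).trans (hδ hne.choose)
  by_cases hσ : σ ∈ d
  · obtain ⟨v, hv, hle⟩ := exists_sdMap_le hc hf hne
    have hgv : g σ / (σ.card : ℝ) ≤ sdMap g v := div_card_le_sdMap hg hσ hv
    have hv' := abs_le.1 (hδ v)
    rcases hle with hle | ⟨w, hw, hle⟩
    · linarith
    · have hgw : g σ / (σ.card : ℝ) + sdMap g w ≤ sdMap g v := div_card_add_sdMap_le hd hg hσ hv hw
      have hw' := abs_le.1 (hδ w)
      linarith
  · rw [hg.2.1 σ hσ, zero_div]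
    have := div_card_nonneg hf σ
    positivity

theorem abs_sub_le_of_sdMap (hc : c ∈ sd K) (hd : d ∈ sd K) (hf : f ∈ openSimplex c)
    (hg : g ∈ openSimplex d) {δ : ℝ} (hδ : ∀ v, |sdMap g v - sdMap f v| ≤ δ) (σ : Finset V) :
    |g σ - f σ| ≤ σ.card * (2 * δ) := by
  rcases σ.eq_empty_or_nonempty with rfl | hne
  · have hempty {e} (he : e ∈ sd K) : ∅ ∉ e := fun h =>
      Finset.not_nonempty_empty (mem_nonempty (he.2.1 ∅ h))
    simp [hf.2.1 ∅ (hempty hc), hg.2.1 ∅ (hempty hd)]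
  · have hcard : 0 < (σ.card : ℝ) := Nat.cast_pos.2 hne.card_pos
    have hfg := div_card_le_add hd hc hg hf (fun v => abs_sub_comm (sdMap g v) _ ▸ hδ v) hne
    have hgf := div_card_le_add hc hd hf hg hδ hne
    rw [← div_le_iff₀' hcard, ← Nat.abs_cast, ← abs_div, sub_div, abs_le]
    constructor <;> linarith

end Subdivision

section LinearExtension

variable {V : Type v} {W : Type v'} {f : W → V} {s t : Finset W} {x y : W → ℝ}

theorem card_push (h : Set.InjOn f s) : (push f s).card = s.card := by
  classical
  exact Finset.card_image_of_injOn h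

theorem linearExtension_eq_sum_filter [DecidableEq V] (hx : ∀ w ∉ s, x w = 0) (v : V) :
    linearExtension f x v = ∑ w ∈ s with f w = v, x w := by
  rw [linearExtension, Finset.sum_filter]
  simp only [finsum_eq_if]
  refine finsum_eq_sum_of_support_subset _ fun w hw => by_contra fun hws => hw ?_
  simp only [hx w hws, ite_self]

theorem linearExtension_eq_zero (hx : ∀ w ∉ s, x w = 0) {v : V} (hv : v ∉ push f s) :
    linearExtension f x v = 0 := by
  classical
  rw [linearExtension_eq_sum_filter hx, Finset.filter_eq_empty_iff.2 fun w hw h =>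
    hv (mem_push.2 ⟨w, hw, h⟩), Finset.sum_empty]

theorem linearExtension_mem_openSimplex (hx : x ∈ openSimplex s) :
    linearExtension f x ∈ openSimplex (push f s) := by
  classical
  refine ⟨fun v hv => ?_, fun v => linearExtension_eq_zero hx.2.1, ?_⟩
  · obtain ⟨w, hw, rfl⟩ := mem_push.1 hv
    rw [linearExtension_eq_sum_filter hx.2.1]
    exact Finset.sum_pos (fun w hw => hx.1 w (Finset.mem_filter.1 hw).1)
      ⟨w, Finset.mem_filter.2 ⟨hw, rfl⟩⟩
  · simp only [linearExtension_eq_sum_filter hx.2.1]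
    rw [Finset.sum_fiberwise_of_maps_to (g := f) fun w hw => mem_push.2 ⟨w, hw, rfl⟩, hx.2.2]

theorem linearExtension_add_smul (hx : ∀ w ∉ s, x w = 0) (hy : ∀ w ∉ s, y w = 0) (a b : ℝ) :
    linearExtension f (a • x + b • y) = a • linearExtension f x + b • linearExtension f y := by
  classical
  funext v
  have hxy (w) (hw : w ∉ s) : (a • x + b • y) w = 0 := by simp [hx w hw, hy w hw]
  simp only [Pi.add_apply, Pi.smul_apply, smul_eq_mul, linearExtension_eq_sum_filter hxy,
    linearExtension_eq_sum_filter hx, linearExtension_eq_sum_filter hy, Finset.mul_sum,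
    ← Finset.sum_add_distrib]

theorem sdMap_linearExtension [DecidableEq V] {p : W → Finset V} (hx : ∀ w ∉ s, x w = 0) (v : V) :
    sdMap (linearExtension p x) v = ∑ w ∈ s with v ∈ p w, x w / ((p w).card : ℝ) := by
  classical
  rw [sdMap_eq_sum_filter fun τ => linearExtension_eq_zero hx]
  rw [← Finset.sum_fiberwise_of_maps_to (t := {τ ∈ push p s | v ∈ τ}) (g := p) fun w hw => by
    simpa [mem_push] using ⟨⟨w, (Finset.mem_filter.1 hw).1, rfl⟩, (Finset.mem_filter.1 hw).2⟩]
  refine Finset.sum_congr rfl fun τ hτ => ?_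
  rw [linearExtension_eq_sum_filter hx, Finset.sum_div, Finset.filter_filter]
  refine Finset.sum_congr (Finset.filter_congr fun w _ => ?_) fun w hw => ?_
  · exact ⟨fun h => ⟨h ▸ (Finset.mem_filter.1 hτ).2, h⟩, fun h => h.2⟩
  · rw [(Finset.mem_filter.1 hw).2.2]

theorem linearExtension_sdMap {c : Finset (Finset W)} {g : Finset W → ℝ}
    (hf : ∀ σ ∈ c, Set.InjOn f σ) (hg : ∀ σ ∉ c, g σ = 0) :
    linearExtension f (sdMap g) = sdMap (linearExtension (push f) g) := by
  classical
  funext v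
  have hvertices (w) (hw : w ∉ c.biUnion id) : sdMap g w = 0 := by
    rw [sdMap_eq_sum_filter hg]
    refine Finset.sum_eq_zero fun σ hσ => absurd (Finset.mem_biUnion.2 ?_) hw
    exact ⟨σ, Finset.mem_filter.1 hσ⟩
  rw [sdMap_linearExtension hg, linearExtension_eq_sum_filter hvertices]
  simp only [sdMap_eq_sum_filter hg]
  rw [Finset.sum_comm' (t' := {σ ∈ c | v ∈ push f σ}) (s' := fun σ => {w ∈ σ | f w = v})]
  · refine Finset.sum_congr rfl fun σ hσv => ?_
    obtain ⟨hσ, hv⟩ := Finset.mem_filter.1 hσv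
    obtain ⟨w, hw, rfl⟩ := mem_push.1 hv
    have hfibre : ({w' ∈ σ | f w' = f w} : Finset W) = {w} := by
      ext w'
      simp only [Finset.mem_filter, Finset.mem_singleton]
      exact ⟨fun h => hf σ hσ h.1 hw h.2, by rintro rfl; exact ⟨hw, rfl⟩⟩
    rw [hfibre, Finset.sum_singleton, card_push (hf σ hσ)]
  · intro w σ
    simp only [Finset.mem_filter, Finset.mem_biUnion, id, mem_push]
    exact ⟨fun ⟨⟨_, hv⟩, hσ, hw⟩ => ⟨⟨hw, hv⟩, hσ, w, hw, hv⟩,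
      fun ⟨⟨hw, hv⟩, hσ, _⟩ => ⟨⟨⟨σ, hσ, hw⟩, hv⟩, hσ, hw⟩⟩

end LinearExtension

namespace SimplicialPair

variable {V : Type v} (P : SimplicialPair V)

/-- The first barycentric subdivision of a simplicial pair; its vertices are the simplices. -/
def sd : SimplicialPair (Finset V) where
  K := PersistentSheaf.sd P.K
  K₀ := PersistentSheaf.sd P.K₀
  le _ hc := ⟨hc.1, fun σ hσ => P.le (hc.2.1 σ hσ), hc.2.2⟩

variable {P}

theorem continuous_coe_apply (v : V) : Continuous fun x : P.space => x.1 v :=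
  (continuous_apply v).comp continuous_subtype_val

theorem eventually_sum_abs_sub_le (x : P.space) {δ : ℝ} (hδ : 0 < δ) :
    ∀ᶠ y : P.space in nhds x, ∀ r : Finset V, ∑ v ∈ r, |y.1 v - x.1 v| ≤ δ := by
  obtain ⟨s, -, -, hs⟩ := x.2
  have hcont : Continuous fun y : P.space => 2 * ∑ v ∈ s, |y.1 v - x.1 v| :=
    continuous_const.mul <| continuous_finsetSum _ fun v _ =>
      ((continuous_coe_apply v).sub continuous_const).abs
  have hlt := hcont.continuousAt.eventually_lt (x₀ := x) (continuousAt_const (y := δ)) (by simpa)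
  filter_upwards [hlt] with y hy r
  obtain ⟨t, -, -, ht⟩ := y.2
  exact (sum_abs_sub_le hs ht r).trans hy.le

theorem sdMap_mem_space {f : Finset V → ℝ} (hf : f ∈ P.sd.space) : sdMap f ∈ P.space := by
  obtain ⟨c, hc, hc₀, hfc⟩ := hf
  obtain ⟨σ, hσ, htop⟩ := exists_top hc
  exact ⟨σ, hc.2.1 σ hσ, mt (mem_sd_iff_of_top hc hσ htop).2 hc₀,
    sdMap_mem_openSimplex hc hσ htop hfc⟩

theorem exists_sdMap_eq {x : V → ℝ} (hx : x ∈ P.space) : ∃ f ∈ P.sd.space, sdMap f = x := by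
  obtain ⟨s, hs, hs₀, hxs⟩ := hx
  obtain ⟨c, hc, f, hf, rfl⟩ := exists_mem_cell₁ hs hxs
  obtain ⟨σ, hσ, htop⟩ := exists_top hc
  obtain rfl : σ = s := openSimplex_inj (sdMap_mem_openSimplex hc hσ htop hf) hxs
  exact ⟨f, ⟨c, hc, mt (mem_sd_iff_of_top hc hσ htop).1 hs₀, hf⟩, rfl⟩

variable (P) in
/-- The identification of the space of the first subdivision with the space of `P`, as a map of
sets. -/
noncomputable def sdEquiv : P.sd.space ≃ P.space :=
  Equiv.ofBijective (fun f => ⟨sdMap f.1, sdMap_mem_space f.2⟩) <| by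
    refine ⟨fun f g h => ?_, fun x => ?_⟩
    · obtain ⟨c, hc, -, hf⟩ := f.2
      obtain ⟨d, hd, -, hg⟩ := g.2
      exact Subtype.ext (sdMap_inj hc hd hf hg (congrArg Subtype.val h))
    · obtain ⟨f, hf, hfx⟩ := exists_sdMap_eq x.2
      exact ⟨⟨f, hf⟩, Subtype.ext hfx⟩

theorem sdMap_sdEquiv_symm (x : P.space) : sdMap (P.sdEquiv.symm x).1 = x.1 :=
  congrArg Subtype.val (P.sdEquiv.apply_symm_apply x)

theorem continuous_sdEquiv : Continuous P.sdEquiv := by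
  classical
  refine Continuous.subtype_mk (continuous_pi fun v => ?_) _
  refine continuous_iff_continuousAt.2 fun f => Metric.tendsto_nhds.2 fun ε hε => ?_
  filter_upwards [eventually_sum_abs_sub_le f (half_pos hε)] with g hfg
  obtain ⟨c, -, -, hf⟩ := f.2
  obtain ⟨d, -, -, hg⟩ := g.2
  exact ((abs_sdMap_sub_le hf hg v).trans (hfg _)).trans_lt (half_lt_self hε)

theorem continuous_sdEquiv_symm : Continuous P.sdEquiv.symm := by
  refine continuous_induced_rng.2 (continuous_pi fun σ => ?_)
  refine continuous_iff_continuousAt.2 fun x => Metric.tendsto_nhds.2 fun ε hε => ?_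
  have hcard : 0 < (σ.card : ℝ) + 1 := by positivity
  have hδ : 0 < ε / (2 * (σ.card + 1)) := by positivity
  filter_upwards [eventually_sum_abs_sub_le x hδ] with y hxy
  obtain ⟨c, hc, -, hf⟩ := (P.sdEquiv.symm x).2
  obtain ⟨d, hd, -, hg⟩ := (P.sdEquiv.symm y).2
  have hle := abs_sub_le_of_sdMap hc hd hf hg (δ := ε / (2 * (σ.card + 1))) (fun v => by
    simpa [sdMap_sdEquiv_symm] using hxy {v}) σ
  calc |(P.sdEquiv.symm y).1 σ - (P.sdEquiv.symm x).1 σ|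
      ≤ σ.card * (2 * (ε / (2 * (σ.card + 1)))) := hle
    _ = ε * (σ.card / (σ.card + 1)) := by field_simp
    _ < ε := mul_lt_of_lt_one_right hε ((div_lt_one hcard).2 (lt_add_one _))

variable (P) in
/-- The identification of the space of the first subdivision with the space of `P`. -/
noncomputable def sdHomeo : P.sd.space ≃ₜ P.space where
  toEquiv := P.sdEquiv
  continuous_toFun := continuous_sdEquiv
  continuous_invFun := continuous_sdEquiv_symm

end SimplicialPair

namespace Triangulation

variable {X : Type u} [TopologicalSpace X] {V : Type v} (T : Triangulation X V)

/-- The triangulation of `X` by the first barycentric subdivision. -/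
noncomputable def sd : Triangulation X (Finset V) where
  toSimplicialPair := T.toSimplicialPair.sd
  homeo := T.sdHomeo.trans T.homeo

theorem sdMap_coord_sd (x : X) : sdMap (T.sd.coord x) = T.coord x :=
  SimplicialPair.sdMap_sdEquiv_symm (T.homeo.symm x)

theorem exists_coord_eq {f : V → ℝ} (hf : f ∈ T.space) : ∃ x, T.coord x = f :=
  ⟨T.homeo ⟨f, hf⟩, T.coord_homeo _⟩

/-- The carrier of a point: the simplex whose interior contains it. -/
noncomputable def carrier (x : X) : Finset V := (T.coord_mem x).choose

variable {T} {s t : Finset V} {x y : X}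

theorem carrier_mem (x : X) : T.carrier x ∈ T.K := (T.coord_mem x).choose_spec.1

theorem carrier_notMem (x : X) : T.carrier x ∉ T.K₀ := (T.coord_mem x).choose_spec.2.1

theorem coord_mem_openSimplex (x : X) : T.coord x ∈ openSimplex (T.carrier x) :=
  (T.coord_mem x).choose_spec.2.2

theorem coord_mem_openSimplex_iff : T.coord x ∈ openSimplex s ↔ T.carrier x = s :=
  ⟨openSimplex_inj (coord_mem_openSimplex x), fun h => h ▸ coord_mem_openSimplex x⟩

theorem exists_carrier_eq (hs : s ∈ T.K) (hs₀ : s ∉ T.K₀) : ∃ x, T.carrier x = s := by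
  obtain ⟨f, hf⟩ := openSimplex_nonempty (mem_nonempty hs)
  obtain ⟨x, rfl⟩ := T.exists_coord_eq ⟨s, hs, hs₀, hf⟩
  exact ⟨x, coord_mem_openSimplex_iff.1 hf⟩

theorem coord_mem_cell₁_iff {c : Finset (Finset V)} (hc : c ∈ PersistentSheaf.sd T.K) :
    T.coord x ∈ cell₁ c ↔ T.sd.carrier x = c := by
  have hx : T.coord x ∈ cell₁ (T.sd.carrier x) :=
    ⟨_, coord_mem_openSimplex x, T.sdMap_coord_sd x⟩
  exact ⟨cell₁_inj (carrier_mem (T := T.sd) x) hc hx, fun h => h ▸ hx⟩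

theorem coord_mem_cell₂_iff {C : Finset (Finset (Finset V))}
    (hC : C ∈ PersistentSheaf.sd (PersistentSheaf.sd T.K)) :
    T.coord x ∈ cell₂ C ↔ T.sd.sd.carrier x = C := by
  have hx : T.coord x ∈ cell₂ (T.sd.sd.carrier x) :=
    ⟨_, ⟨_, coord_mem_openSimplex x, T.sd.sdMap_coord_sd x⟩, T.sdMap_coord_sd x⟩
  exact ⟨cell₂_inj (carrier_mem (T := T.sd.sd) x) hC hx, fun h => h ▸ hx⟩

theorem isTop_carrier_sd (x : X) :
    T.carrier x ∈ T.sd.carrier x ∧ ∀ σ ∈ T.sd.carrier x, σ ⊆ T.carrier x := by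
  obtain ⟨σ, hσ, htop⟩ := exists_top (carrier_mem (T := T.sd) x)
  have hx := sdMap_mem_openSimplex (carrier_mem (T := T.sd) x) hσ htop (coord_mem_openSimplex x)
  rw [sdMap_coord_sd, coord_mem_openSimplex_iff] at hx
  exact hx ▸ ⟨hσ, htop⟩

variable (T) in
/-- The open star of `s`: the points whose carrier has `s` as a face. -/
def openStar (s : Finset V) : Set X := {x | s ⊆ T.carrier x}

theorem isOpen_openStar (s : Finset V) : IsOpen (T.openStar s) := by
  have hstar : T.openStar s = ⋂ v ∈ s, {x | 0 < T.coord x v} := by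
    ext x
    simp only [Set.mem_iInter₂]
    exact forall₂_congr fun v _ => mem_iff_pos_of_mem_openSimplex (coord_mem_openSimplex x)
  rw [hstar]
  exact isOpen_biInter_finset fun v _ => isOpen_lt continuous_const
    ((continuous_apply v).comp T.isEmbedding_coord.continuous)

end Triangulation

namespace Triangulation

variable {X : Type u} [TopologicalSpace X] {V : Type v} {T : Triangulation X V}
  {s : Finset V} {x y z : X} {U : Set X}

theorem subset_carrier_iff (hx : x ∈ U) (hU : U ⊆ T.openStar (T.carrier x)) :
    s ⊆ T.carrier x ↔ U ⊆ T.openStar s :=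
  ⟨fun h _ hy => h.trans (hU hy), fun h => h hx⟩

theorem mem_openStar_carrier (x : X) : x ∈ T.openStar (T.carrier x) :=
  Finset.Subset.refl (T.carrier x)

theorem coord_add_smul_of_sd {a b : ℝ}
    (h : T.sd.coord z = a • T.sd.coord x + b • T.sd.coord y) :
    T.coord z = a • T.coord x + b • T.coord y := by
  classical
  rw [← T.sdMap_coord_sd x, ← T.sdMap_coord_sd y, ← T.sdMap_coord_sd z, h]
  exact sdMap_add_smul (c := T.sd.carrier x ∪ T.sd.carrier y)
    (fun σ hσ => (coord_mem_openSimplex x).2.1 σ fun h => hσ (Finset.mem_union_left _ h))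
    (fun σ hσ => (coord_mem_openSimplex y).2.1 σ fun h => hσ (Finset.mem_union_right _ h)) a b

theorem starConvex_of_sd (h : StarConvex ℝ (T.sd.coord x) (T.sd.coord '' U)) :
    StarConvex ℝ (T.coord x) (T.coord '' U) := by
  rintro _ ⟨y, hy, rfl⟩ a b ha hb hab
  obtain ⟨z, hz, hzx⟩ := h ⟨y, hy, rfl⟩ ha hb hab
  exact ⟨z, hz, coord_add_smul_of_sd hzx⟩

theorem starConvex_openStar (x : X) :
    StarConvex ℝ (T.coord x) (T.coord '' T.openStar (T.carrier x)) := by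
  rintro _ ⟨y, hy, rfl⟩ a b ha hb hab
  rcases hb.eq_or_lt with rfl | hb
  · obtain rfl : a = 1 := by simpa using hab
    exact ⟨x, mem_openStar_carrier x, by simp⟩
  · have hmem : a • T.coord x + b • T.coord y ∈ openSimplex (T.carrier y) :=
      add_smul_mem_openSimplex hy (coord_mem_openSimplex x) (coord_mem_openSimplex y) ha hb hab
    obtain ⟨z, hz⟩ := T.exists_coord_eq ⟨_, carrier_mem y, carrier_notMem y, hmem⟩
    rw [← hz, coord_mem_openSimplex_iff] at hmem
    exact ⟨z, hy.trans hmem.ge, hz⟩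

theorem isBasicAt_iff {U : Opens X} : T.IsBasicAt T.K openSimplex s U ↔
    ∃ x ∈ U, T.carrier x = s ∧ (U : Set X) ⊆ T.openStar s ∧
      StarConvex ℝ (T.coord x) (T.coord '' U) := by
  constructor
  · rintro ⟨-, hU, x, hxU, hx, hstar⟩
    refine ⟨x, hxU, coord_mem_openSimplex_iff.1 hx, fun y hy => ?_, hstar⟩
    obtain ⟨t, -, hst, hyt⟩ := hU y hy
    rwa [openStar, Set.mem_ofPred_eq, coord_mem_openSimplex_iff.1 hyt]
  · rintro ⟨x, hxU, rfl, hU, hstar⟩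
    exact ⟨carrier_mem x, fun y hy => ⟨_, carrier_mem y, hU hy, coord_mem_openSimplex y⟩,
      x, hxU, coord_mem_openSimplex x, hstar⟩

theorem isBasicAt_cell₂_iff {C : Finset (Finset (Finset V))} {U : Opens X} :
    T.IsBasicAt (PersistentSheaf.sd (PersistentSheaf.sd T.K)) cell₂ C U ↔
      ∃ x ∈ U, T.sd.sd.carrier x = C ∧ (U : Set X) ⊆ T.sd.sd.openStar C ∧
        StarConvex ℝ (T.coord x) (T.coord '' U) := by
  constructor
  · rintro ⟨hC, hU, x, hxU, hx, hstar⟩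
    refine ⟨x, hxU, (coord_mem_cell₂_iff hC).1 hx, fun y hy => ?_, hstar⟩
    obtain ⟨D, hD, hCD, hyD⟩ := hU y hy
    rwa [openStar, Set.mem_ofPred_eq, (coord_mem_cell₂_iff hD).1 hyD]
  · have hcell (y : X) : T.coord y ∈ cell₂ (T.sd.sd.carrier y) :=
      (coord_mem_cell₂_iff (carrier_mem (T := T.sd.sd) y)).2 rfl
    rintro ⟨x, hxU, rfl, hU, hstar⟩
    exact ⟨carrier_mem (T := T.sd.sd) x,
      fun y hy => ⟨_, carrier_mem (T := T.sd.sd) y, hU hy, hcell y⟩, x, hxU, hcell x, hstar⟩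

theorem isBasicAt_openStar (hs : s ∈ T.K) (hs₀ : s ∉ T.K₀) :
    T.IsBasicAt T.K openSimplex s ⟨T.openStar s, isOpen_openStar s⟩ := by
  obtain ⟨x, rfl⟩ := exists_carrier_eq hs hs₀
  exact isBasicAt_iff.2 ⟨x, mem_openStar_carrier x, rfl, subset_rfl, starConvex_openStar x⟩

theorem star₁_eq_openStar (e : Finset (Finset V)) : T.star₁ e = T.sd.openStar e := by
  ext x
  constructor
  · rintro ⟨d, hd, hed, hx⟩
    rwa [openStar, Set.mem_ofPred_eq, (coord_mem_cell₁_iff hd).1 hx]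
  · exact fun h => ⟨_, carrier_mem (T := T.sd) x, h,
      (coord_mem_cell₁_iff (carrier_mem (T := T.sd) x)).2 rfl⟩

theorem isBasicAt_star₁ {c : Finset (Finset V)} (hc : c ∈ PersistentSheaf.sd T.K)
    (hc₀ : c ∉ PersistentSheaf.sd T.K₀) (hs : s ∈ c) (htop : ∀ σ ∈ c, σ ⊆ s) :
    T.IsBasicAt T.K openSimplex s ⟨T.star₁ c, T.isOpen_star₁ hc⟩ := by
  obtain ⟨x, rfl⟩ := exists_carrier_eq (T := T.sd) hc hc₀
  obtain ⟨hx, hxtop⟩ := isTop_carrier_sd x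
  refine isBasicAt_iff.2 ⟨x, ?_, (htop _ hx).antisymm (hxtop s hs), ?_, ?_⟩ <;>
    simp only [← SetLike.mem_coe, Opens.coe_mk, star₁_eq_openStar]
  · exact mem_openStar_carrier (T := T.sd) x
  · exact fun y hy => (isTop_carrier_sd y).2 s (hy hs)
  · exact starConvex_of_sd (starConvex_openStar x)

theorem mem_shrinking_iff : x ∈ T.shrinking ↔ lowest (T.sd.sd.carrier x) ∉ T.K₀ := by
  have hmem := carrier_mem (T := T.sd.sd) x
  rw [← mem_closedStar_iff hmem]
  constructor
  · rintro ⟨C, hC, hC₀, hx⟩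
    rwa [(coord_mem_cell₂_iff hC).1 hx]
  · exact fun h => ⟨_, hmem, h, (coord_mem_cell₂_iff hmem).2 rfl⟩

theorem eventually_exists_coord_eq (hU : StarConvex ℝ (T.coord x) (T.coord '' U)) (hy : y ∈ U)
    {O : Set X} (hO : O ∈ nhds x) :
    ∀ᶠ ε in nhdsWithin (0 : ℝ) (Set.Ioi 0),
      ∃ z ∈ O, T.coord z = (1 - ε) • T.coord x + ε • T.coord y := by
  rw [T.isEmbedding_coord.isInducing.nhds_eq_comap] at hO
  obtain ⟨O', hO', hOO'⟩ := hO
  have hcont : Continuous fun ε : ℝ => (1 - ε) • T.coord x + ε • T.coord y := by fun_prop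
  have hnear : ∀ᶠ ε in nhdsWithin (0 : ℝ) (Set.Ioi 0),
      (1 - ε) • T.coord x + ε • T.coord y ∈ O' :=
    ((hcont.tendsto' 0 (T.coord x) (by simp)).mono_left nhdsWithin_le_nhds).eventually hO'
  filter_upwards [hnear, Ioc_mem_nhdsGT (zero_lt_one' ℝ)] with ε hε hε₁
  obtain ⟨z, -, hz⟩ := hU ⟨y, hy, rfl⟩ (sub_nonneg.2 hε₁.2) hε₁.1.le (by ring)
  exact ⟨z, hOO' (show T.coord z ∈ O' from hz ▸ hε), hz⟩

end Triangulation

theorem isPreconnected_of_image {X : Type u} [TopologicalSpace X] {Y : Type u'}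
    [TopologicalSpace Y] {f : Y → X} (hf : IsLocalHomeomorph f) {U : Set Y} (hU : IsOpen U)
    (hinj : Set.InjOn f U) (h : IsPreconnected (f '' U)) : IsPreconnected U := by
  have hind : Topology.IsInducing (U.domRestrict f) :=
    ((hf.comp hU.isOpenEmbedding_subtypeVal.isLocalHomeomorph).isOpenEmbedding_of_injective
      (Set.injOn_iff_injective.1 hinj)).isInducing
  rw [isPreconnected_iff_preconnectedSpace, preconnectedSpace_iff_univ,
    ← hind.isPreconnected_image, Set.image_univ, Set.range_domRestrict]
  exact h

/-- The map `a` is étale and is, in barycentric coordinates, the simplicial map with vertex map `ψ`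
from the triangulation `L` to the triangulation `T`. -/
structure IsSimplicialEtale {M : Type u} [TopologicalSpace M] {A : Type u'} [TopologicalSpace A]
    {V : Type v} {W : Type v'} (T : Triangulation M V) (a : A → M) (L : Triangulation A W)
    (ψ : W → V) : Prop where
  isLocalHomeomorph : IsLocalHomeomorph a
  push_mem : ∀ s ∈ L.K, push ψ s ∈ T.K
  comm : ∀ x, T.coord (a x) = linearExtension ψ (L.coord x)

namespace IsSimplicialEtale

open Triangulation

variable {M : Type u} [TopologicalSpace M] {A : Type u'} [TopologicalSpace A] {V : Type v}
  {W : Type v'} {T : Triangulation M V} {a : A → M} {L : Triangulation A W} {ψ : W → V}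
  {x y z : A}

theorem carrier_apply (ha : IsSimplicialEtale T a L ψ) (x : A) :
    T.carrier (a x) = push ψ (L.carrier x) := by
  rw [← coord_mem_openSimplex_iff, ha.comm]
  exact linearExtension_mem_openSimplex (coord_mem_openSimplex x)

theorem push_notMem (ha : IsSimplicialEtale T a L ψ) {s : Finset W} (hs : s ∈ L.K)
    (hs₀ : s ∉ L.K₀) : push ψ s ∉ T.K₀ := by
  obtain ⟨x, rfl⟩ := exists_carrier_eq hs hs₀
  exact ha.carrier_apply x ▸ carrier_notMem (a x)

theorem coord_add_smul (ha : IsSimplicialEtale T a L ψ) {b c : ℝ}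
    (h : L.coord z = b • L.coord x + c • L.coord y) :
    T.coord (a z) = b • T.coord (a x) + c • T.coord (a y) := by
  classical
  rw [ha.comm, ha.comm, ha.comm, h]
  exact linearExtension_add_smul (s := L.carrier x ∪ L.carrier y)
    (fun w hw => (coord_mem_openSimplex x).2.1 w fun h => hw (Finset.mem_union_left _ h))
    (fun w hw => (coord_mem_openSimplex y).2.1 w fun h => hw (Finset.mem_union_right _ h)) b c

theorem starConvex_image (ha : IsSimplicialEtale T a L ψ) {U : Set A}
    (h : StarConvex ℝ (L.coord x) (L.coord '' U)) :
    StarConvex ℝ (T.coord (a x)) (T.coord '' (a '' U)) := by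
  rintro _ ⟨_, ⟨y, hy, rfl⟩, rfl⟩ b c hb hc hbc
  obtain ⟨z, hz, hzx⟩ := h ⟨y, hy, rfl⟩ hb hc hbc
  exact ⟨_, ⟨z, hz, rfl⟩, ha.coord_add_smul hzx⟩

theorem injOn_openStar (ha : IsSimplicialEtale T a L ψ) (x : A) :
    Set.InjOn a (L.openStar (L.carrier x)) := by
  intro y hy y' hy' hyy
  -- Move `y` and `y'` along segments towards `x`, until `a` is injective near them.
  obtain ⟨e, hxe, rfl⟩ := ha.isLocalHomeomorph x
  have hO := e.open_source.mem_nhds hxe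
  obtain ⟨ε, ⟨⟨z, hz, hzy⟩, z', hz', hzy'⟩, hε⟩ :=
    (((eventually_exists_coord_eq (starConvex_openStar x) hy hO).and
      (eventually_exists_coord_eq (starConvex_openStar x) hy' hO)).and
        self_mem_nhdsWithin).exists
  obtain rfl : z = z' := by
    refine e.injOn hz hz' (T.isEmbedding_coord.injective ?_)
    rw [ha.coord_add_smul hzy, ha.coord_add_smul hzy', hyy]
  refine L.isEmbedding_coord.injective (smul_right_injective _ (ne_of_gt hε) ?_)
  exact add_left_cancel (hzy.symm.trans hzy')

theorem injOn_vertices (ha : IsSimplicialEtale T a L ψ) (x : A) :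
    Set.InjOn ψ (L.carrier x : Set W) := by
  classical
  intro w hw w' hw' hψ
  by_contra hne
  -- Shift weight from `w'` to `w`: this moves the point of the simplex but not its image.
  have hx := coord_mem_openSimplex (T := L) x
  set δ := L.coord x w' / 2 with hδ
  have hδ₀ : 0 < δ := half_pos (hx.1 w' hw')
  let f : W → ℝ := L.coord x + Pi.single w δ - Pi.single w' δ
  have hf : f ∈ openSimplex (L.carrier x) := by
    refine ⟨fun v hv => ?_, fun v hv => ?_, ?_⟩
    · have hv := hx.1 v hv
      simp only [f, Pi.add_apply, Pi.sub_apply, Pi.single_apply]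
      split_ifs <;> grind
    · simp [f, hx.2.1 v hv, ne_of_mem_of_not_mem hw hv |>.symm,
        ne_of_mem_of_not_mem hw' hv |>.symm]
    · simp [f, Finset.sum_add_distrib, hx.2.2, Finset.mem_coe.1 hw, Finset.mem_coe.1 hw']
  obtain ⟨y, hy⟩ := L.exists_coord_eq ⟨_, carrier_mem x, carrier_notMem x, hf⟩
  have hxy : L.carrier y = L.carrier x := coord_mem_openSimplex_iff.1 (hy ▸ hf)
  have himage : T.coord (a y) = T.coord (a x) := by
    funext v
    rw [ha.comm, ha.comm, hy, linearExtension_eq_sum_filter hf.2.1,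
      linearExtension_eq_sum_filter hx.2.1]
    simp [f, Finset.sum_add_distrib, Finset.mem_coe.1 hw, Finset.mem_coe.1 hw', hψ]
  obtain rfl := ha.injOn_openStar x hxy.ge (mem_openStar_carrier x)
    (T.isEmbedding_coord.injective himage)
  have hw := congrFun hy w
  simp [f, hne, hδ₀.ne'] at hw

theorem subset_openStar (ha : IsSimplicialEtale T a L ψ) {U : Set A} (hconn : IsPreconnected U)
    (hx : x ∈ U) (hU : a '' U ⊆ T.openStar (T.carrier (a x))) :
    U ⊆ L.openStar (L.carrier x) := by
  suffices ∀ w ∈ L.carrier x, U ⊆ L.openStar {w} from fun y hy w hw =>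
    Finset.singleton_subset_iff.1 (this w hw hy)
  intro w hw
  refine hconn.subset_left_of_subset_union (isOpen_openStar {w})
    (v := ⋃ w' ∈ {w' | w' ≠ w ∧ ψ w' = ψ w}, L.openStar {w'})
    (isOpen_biUnion fun w' _ => isOpen_openStar {w'}) ?_ ?_
    ⟨x, hx, Finset.singleton_subset_iff.2 hw⟩
  · refine Set.disjoint_left.2 fun z hz hz' => ?_
    obtain ⟨w', ⟨hne, hψ⟩, hz'⟩ := Set.mem_iUnion₂.1 hz'
    exact hne (ha.injOn_vertices z (Finset.singleton_subset_iff.1 hz')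
      (Finset.singleton_subset_iff.1 hz) hψ)
  · intro z hz
    have hle : push ψ (L.carrier x) ⊆ push ψ (L.carrier z) := by
      simpa only [← ha.carrier_apply] using! hU ⟨z, hz, rfl⟩
    obtain ⟨w', hw', hψ⟩ := mem_push.1 (hle (mem_push.2 ⟨w, hw, rfl⟩))
    by_cases hne : w' = w
    · exact Or.inl (Finset.singleton_subset_iff.2 (hne ▸ hw'))
    · exact Or.inr (Set.mem_iUnion₂.2 ⟨w', ⟨hne, hψ⟩, Finset.singleton_subset_iff.2 hw'⟩)

theorem sd (ha : IsSimplicialEtale T a L ψ) : IsSimplicialEtale T.sd a L.sd (push ψ) where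
  isLocalHomeomorph := ha.isLocalHomeomorph
  push_mem _ := push_mem_sd ha.push_mem
  comm x := by
    have hx := coord_mem_openSimplex (T := L.sd) x
    refine sdMap_inj (carrier_mem (T := T.sd) (a x))
      (push_mem_sd ha.push_mem (carrier_mem (T := L.sd) x)) (coord_mem_openSimplex (a x))
      (linearExtension_mem_openSimplex hx) ?_
    have hinj : ∀ σ ∈ L.sd.carrier x, Set.InjOn ψ σ := fun σ hσ =>
      (ha.injOn_vertices x).mono (Finset.coe_subset.2 ((isTop_carrier_sd x).2 σ hσ))
    rw [sdMap_coord_sd, ha.comm, ← sdMap_coord_sd, linearExtension_sdMap hinj hx.2.1]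

theorem image_openStar_subset (ha : IsSimplicialEtale T a L ψ) (s : Finset W) :
    a '' L.openStar s ⊆ T.openStar (push ψ s) := by
  rintro _ ⟨y, hy, rfl⟩
  exact (push_mono hy).trans (ha.carrier_apply y).ge

theorem isBasicAt_image_openStar (ha : IsSimplicialEtale T a L ψ) (x : A) :
    T.IsBasicAt T.K openSimplex (push ψ (L.carrier x))
      ⟨a '' L.openStar (L.carrier x), ha.isLocalHomeomorph.isOpenMap _ (isOpen_openStar _)⟩ :=
  isBasicAt_iff.2 ⟨a x, ⟨x, mem_openStar_carrier x, rfl⟩, ha.carrier_apply x,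
    ha.image_openStar_subset _, ha.starConvex_image (starConvex_openStar x)⟩

theorem isBasicAt_cell₂_image_openStar (ha : IsSimplicialEtale T a L ψ) (x : A) :
    T.IsBasicAt (PersistentSheaf.sd (PersistentSheaf.sd T.K)) cell₂
      (push (push (push ψ)) (L.sd.sd.carrier x))
      ⟨a '' L.sd.sd.openStar (L.sd.sd.carrier x),
        ha.isLocalHomeomorph.isOpenMap _ (isOpen_openStar _)⟩ :=
  isBasicAt_cell₂_iff.2 ⟨a x, ⟨x, mem_openStar_carrier (T := L.sd.sd) x, rfl⟩,
    ha.sd.sd.carrier_apply x, ha.sd.sd.image_openStar_subset _,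
    ha.starConvex_image (starConvex_of_sd (starConvex_of_sd (starConvex_openStar x)))⟩

end IsSimplicialEtale

namespace IsSimplicialEtale

open Triangulation

variable {M : Type u} [TopologicalSpace M] {A : Type u'} [TopologicalSpace A] {V : Type v}
  {W : Type v'} {T : Triangulation M V} {a : A → M} {L : Triangulation A W} {ψ : W → V}

/-- The basic open sets of the stratification of `A` pulled back from `K`. -/
abbrev BasicOpens (ha : IsSimplicialEtale T a L ψ) : Type u' :=
  EtaleBasic a ha.isLocalHomeomorph Set.univ T.IsBasic

/-- The basic open sets of the stratification of the shrinking of `A` pulled back from `K²`. -/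
abbrev ShrinkingBasicOpens (ha : IsSimplicialEtale T a L ψ) : Type u' :=
  EtaleBasic a ha.isLocalHomeomorph L.shrinking T.IsDilationBasic

section Strata

theorem exists_center (ha : IsSimplicialEtale T a L ψ) (U : ha.BasicOpens) :
    ∃ x ∈ U.1, (U.1 : Set A) ⊆ L.openStar (L.carrier x) ∧
      T.IsBasicAt T.K openSimplex (push ψ (L.carrier x))
        ⟨a '' U.1, ha.isLocalHomeomorph.isOpenMap _ U.1.2⟩ := by
  obtain ⟨U, -, hinj, σ, hσ⟩ := U
  obtain ⟨_, ⟨x, hx, rfl⟩, rfl, hU, -⟩ := isBasicAt_iff.1 hσ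
  have hconn := (IsBasic.isConnected ⟨_, hσ⟩).isPreconnected
  exact ⟨x, hx, ha.subset_openStar
    (isPreconnected_of_image ha.isLocalHomeomorph U.2 hinj hconn) hx hU, ha.carrier_apply x ▸ hσ⟩

/-- A point about which the image of a basic open set is star-shaped. -/
noncomputable def center (ha : IsSimplicialEtale T a L ψ) (U : ha.BasicOpens) : A :=
  (ha.exists_center U).choose

theorem center_mem (ha : IsSimplicialEtale T a L ψ) (U : ha.BasicOpens) : ha.center U ∈ U.1 :=
  (ha.exists_center U).choose_spec.1

theorem subset_openStar_center (ha : IsSimplicialEtale T a L ψ) (U : ha.BasicOpens) :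
    (U.1 : Set A) ⊆ L.openStar (L.carrier (ha.center U)) :=
  (ha.exists_center U).choose_spec.2.1

/-- The stratum of `A` with which a basic open set is associated. -/
noncomputable def stratum (ha : IsSimplicialEtale T a L ψ) : ha.BasicOpens →o L.Stratum where
  toFun U := .toDual ⟨L.carrier (ha.center U), carrier_mem _, carrier_notMem _⟩
  monotone' U' U h := ha.subset_openStar_center U (h (ha.center_mem U'))

theorem isBasicAt_image (ha : IsSimplicialEtale T a L ψ) (U : ha.BasicOpens) :
    T.IsBasicAt T.K openSimplex (push ψ (ha.stratum U).ofDual.1)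
      ⟨a '' U.1, ha.isLocalHomeomorph.isOpenMap _ U.1.2⟩ :=
  (ha.exists_center U).choose_spec.2.2

/-- The open star of a stratum of `A`, the largest basic open set associated with it. -/
def starOpen (ha : IsSimplicialEtale T a L ψ) (s : L.Stratum) : ha.BasicOpens :=
  ⟨⟨L.openStar s.ofDual.1, isOpen_openStar _⟩, Set.subset_univ _, by
    obtain ⟨x, hx⟩ := exists_carrier_eq s.mem s.notMem
    exact hx ▸ ⟨ha.injOn_openStar x, _, ha.isBasicAt_image_openStar x⟩⟩

theorem isConnectedQuotient_stratum (ha : IsSimplicialEtale T a L ψ) :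
    IsConnectedQuotient ha.stratum := by
  have gc : GaloisConnection ha.stratum ha.starOpen := fun U _ =>
    subset_carrier_iff (ha.center_mem U) (ha.subset_openStar_center U)
  refine .of_galoisInsertion (gc.toGaloisInsertion fun s => ?_)
  obtain ⟨x, hx⟩ := exists_carrier_eq s.mem s.notMem
  exact SimplicialPair.Stratum.le_iff.2 <|
    (ha.subset_openStar_center (ha.starOpen s) hx.ge).trans hx.le

end Strata

section ShrinkingStrata

theorem exists_shrinkingCenter (ha : IsSimplicialEtale T a L ψ) (U : ha.ShrinkingBasicOpens) :
    ∃ x ∈ U.1, (U.1 : Set A) ⊆ L.sd.sd.openStar (L.sd.sd.carrier x) ∧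
      T.IsBasicAt (PersistentSheaf.sd (PersistentSheaf.sd T.K)) cell₂
        (push (push (push ψ)) (L.sd.sd.carrier x))
        ⟨a '' U.1, ha.isLocalHomeomorph.isOpenMap _ U.1.2⟩ := by
  obtain ⟨U, -, hinj, hbasic⟩ := U
  obtain ⟨C, -, hC⟩ := id hbasic
  obtain ⟨_, ⟨x, hx, rfl⟩, rfl, hU, -⟩ := isBasicAt_cell₂_iff.1 hC
  exact ⟨x, hx, ha.sd.sd.subset_openStar (isPreconnected_of_image ha.isLocalHomeomorph U.2 hinj
    hbasic.isBasic.isConnected.isPreconnected) hx hU, ha.sd.sd.carrier_apply x ▸ hC⟩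

/-- A point about which the image of a basic open set of the second subdivision is star-shaped. -/
noncomputable def shrinkingCenter (ha : IsSimplicialEtale T a L ψ) (U : ha.ShrinkingBasicOpens) :
    A :=
  (ha.exists_shrinkingCenter U).choose

theorem shrinkingCenter_mem (ha : IsSimplicialEtale T a L ψ) (U : ha.ShrinkingBasicOpens) :
    ha.shrinkingCenter U ∈ U.1 :=
  (ha.exists_shrinkingCenter U).choose_spec.1

theorem subset_openStar_shrinkingCenter (ha : IsSimplicialEtale T a L ψ)
    (U : ha.ShrinkingBasicOpens) :
    (U.1 : Set A) ⊆ L.sd.sd.openStar (L.sd.sd.carrier (ha.shrinkingCenter U)) :=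
  (ha.exists_shrinkingCenter U).choose_spec.2.1

/-- The stratum of the shrinking with which a basic open set is associated. -/
noncomputable def shrinkingStratum (ha : IsSimplicialEtale T a L ψ) :
    ha.ShrinkingBasicOpens →o L.ShrinkingStratum where
  toFun U := .toDual ⟨L.sd.sd.carrier (ha.shrinkingCenter U), carrier_mem (T := L.sd.sd) _,
    mem_shrinking_iff.1 (U.2.1 (ha.shrinkingCenter_mem U))⟩
  monotone' U' U h := ha.subset_openStar_shrinkingCenter U (h (ha.shrinkingCenter_mem U'))

theorem isBasicAt_cell₂_image (ha : IsSimplicialEtale T a L ψ) (U : ha.ShrinkingBasicOpens) :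
    T.IsBasicAt (PersistentSheaf.sd (PersistentSheaf.sd T.K)) cell₂
      (push (push (push ψ)) (ha.shrinkingStratum U).ofDual.1)
      ⟨a '' U.1, ha.isLocalHomeomorph.isOpenMap _ U.1.2⟩ :=
  (ha.exists_shrinkingCenter U).choose_spec.2.2

theorem push_mem_sd_sd (ha : IsSimplicialEtale T a L ψ) (D : L.ShrinkingStratum) :
    push (push (push ψ)) D.ofDual.1 ∈ PersistentSheaf.sd (PersistentSheaf.sd T.K) :=
  ha.sd.sd.push_mem _ D.mem

theorem dilation_push_notMem (ha : IsSimplicialEtale T a L ψ) (D : L.ShrinkingStratum) :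
    dilation (push (push (push ψ)) D.ofDual.1) ∉ PersistentSheaf.sd T.K₀ := by
  rw [dilation_mem_sd_iff (ha.push_mem_sd_sd D), lowest_push ha.push_mem D.mem]
  exact ha.push_notMem (lowest_mem D.mem) D.notMem

theorem exists_carrier_sd_sd_eq (D : L.ShrinkingStratum) : ∃ x, L.sd.sd.carrier x = D.ofDual.1 :=
  exists_carrier_eq (T := L.sd.sd) D.mem fun h => D.notMem (lowest_mem h)

theorem openStar_subset_shrinking (D : L.ShrinkingStratum) :
    L.sd.sd.openStar D.ofDual.1 ⊆ L.shrinking := fun x hx =>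
  have hxD := carrier_mem (T := L.sd.sd) x
  mem_shrinking_iff.2 fun h => D.notMem <|
    (L.K₀.isRelLowerSet_faces h).2 (lowest_mono D.mem hxD hx) (mem_nonempty (lowest_mem D.mem))

/-- The open star of a stratum of the shrinking, the largest basic open set associated with it. -/
def shrinkingStarOpen (ha : IsSimplicialEtale T a L ψ) (D : L.ShrinkingStratum) :
    ha.ShrinkingBasicOpens :=
  ⟨⟨L.sd.sd.openStar D.ofDual.1, isOpen_openStar _⟩, openStar_subset_shrinking D, by
    obtain ⟨x, hx⟩ := exists_carrier_sd_sd_eq D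
    have hD := ha.dilation_push_notMem D
    rw [← hx] at hD
    exact hx ▸ ⟨ha.sd.sd.injOn_openStar x, _, hD, ha.isBasicAt_cell₂_image_openStar x⟩⟩

theorem isConnectedQuotient_shrinkingStratum (ha : IsSimplicialEtale T a L ψ) :
    IsConnectedQuotient ha.shrinkingStratum := by
  have gc : GaloisConnection ha.shrinkingStratum ha.shrinkingStarOpen := fun U _ =>
    subset_carrier_iff (ha.shrinkingCenter_mem U) (ha.subset_openStar_shrinkingCenter U)
  refine .of_galoisInsertion (gc.toGaloisInsertion fun D => ?_)
  obtain ⟨x, hx⟩ := exists_carrier_sd_sd_eq D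
  exact SimplicialPair.ShrinkingStratum.le_iff.2 <|
    (ha.subset_openStar_shrinkingCenter (ha.shrinkingStarOpen D) hx.ge).trans hx.le

/-- The stratum of `A` onto which the dilation maps the stratum of a basic open set. -/
noncomputable def lowestStratum (ha : IsSimplicialEtale T a L ψ) :
    ha.ShrinkingBasicOpens →o L.Stratum :=
  L.lowestHom.comp ha.shrinkingStratum

theorem ofDual_lowestStratum (ha : IsSimplicialEtale T a L ψ) (U : ha.ShrinkingBasicOpens) :
    (ha.lowestStratum U).ofDual.1 = lowest (ha.shrinkingStratum U).ofDual.1 :=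
  SimplicialPair.ofDual_lowestHom (ha.shrinkingStratum U)

theorem isConnectedQuotient_lowestStratum (ha : IsSimplicialEtale T a L ψ) :
    IsConnectedQuotient ha.lowestStratum :=
  SimplicialPair.isConnectedQuotient_lowestHom.comp ha.isConnectedQuotient_shrinkingStratum

theorem isBasicAt_dilateSet (ha : IsSimplicialEtale T a L ψ) (U : ha.ShrinkingBasicOpens) :
    T.IsBasicAt T.K openSimplex (push ψ (ha.lowestStratum U).ofDual.1)
      ⟨T.dilateSet (a '' U.1), U.2.2.2.isOpen⟩ := by
  have hC := ha.push_mem_sd_sd (ha.shrinkingStratum U)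
  have hU : (⟨T.dilateSet (a '' U.1), U.2.2.2.isOpen⟩ : Opens M) =
      ⟨T.star₁ (dilation (push (push (push ψ)) (ha.shrinkingStratum U).ofDual.1)),
        T.isOpen_star₁ (dilation_mem hC)⟩ :=
    Opens.ext (dilateSet_eq (ha.isBasicAt_cell₂_image U))
  rw [hU, ofDual_lowestStratum, ← lowest_push ha.push_mem (ha.shrinkingStratum U).mem]
  exact isBasicAt_star₁ (dilation_mem hC) (ha.dilation_push_notMem _) (lowest_mem_dilation hC)
    fun _ => subset_lowest_of_mem_dilation hC

theorem stratum_le_lowestStratum (ha : IsSimplicialEtale T a L ψ) :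
    ha.stratum.comp (shrinkingMap T a ha.isLocalHomeomorph L) ≤ ha.lowestStratum := fun U => by
  let D := ha.shrinkingStratum U
  let x := ha.center (shrinkingMap T a ha.isLocalHomeomorph L U)
  have hD : D.ofDual.1 ⊆ L.sd.sd.carrier x :=
    ha.subset_openStar_shrinkingCenter U (ha.center_mem (shrinkingMap T a _ L U))
  have hvertex : dilationVertex D.ofDual.1 ⊆ L.sd.carrier x :=
    (isTop_carrier_sd (T := L.sd) x).2 _ (hD (dilationVertex_mem_of_mem_sd D.mem))
  rw [SimplicialPair.Stratum.le_iff, ofDual_lowestStratum]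
  exact (isTop_carrier_sd x).2 _ (hvertex (lowest_mem_dilationVertex D.mem))

end ShrinkingStrata

section PullBack

theorem isBasicAt_star (ha : IsSimplicialEtale T a L ψ) (s : L.Stratum) :
    T.IsBasicAt T.K openSimplex (push ψ s.ofDual.1)
      ⟨T.openStar (push ψ s.ofDual.1), isOpen_openStar _⟩ :=
  isBasicAt_openStar (ha.push_mem _ s.mem) (ha.push_notMem s.mem s.notMem)

/-- The open stars in `M` of the images of the strata of `A`. -/
def starMap (ha : IsSimplicialEtale T a L ψ) : L.Stratum →o ConnOpens M where
  toFun s := ⟨_, IsBasic.isConnected ⟨_, ha.isBasicAt_star s⟩⟩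
  monotone' _ _ h _ hx := (push_mono (SimplicialPair.Stratum.le_iff.1 h)).trans hx

/-- The images in `M` of the basic open sets of `A`. -/
def imageMap (ha : IsSimplicialEtale T a L ψ) : ha.BasicOpens →o ConnOpens M where
  toFun U := ⟨_, U.2.2.2.isConnected⟩
  monotone' _ _ h := Set.image_mono h

/-- The dilations of the images in `M` of the basic open sets of the shrinking of `A`. -/
def dilateMap (ha : IsSimplicialEtale T a L ψ) : ha.ShrinkingBasicOpens →o ConnOpens M where
  toFun U := ⟨⟨T.dilateSet (a '' U.1), U.2.2.2.isOpen⟩, U.2.2.2.isConnected⟩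
  monotone' _ _ h := dilateSet_mono (Set.image_mono h)

theorem imageMap_le (ha : IsSimplicialEtale T a L ψ) :
    ha.imageMap ≤ ha.starMap.comp ha.stratum := fun U =>
  let ⟨_, _, _, h, _⟩ := isBasicAt_iff.1 (ha.isBasicAt_image U)
  h

theorem dilateMap_le (ha : IsSimplicialEtale T a L ψ) :
    ha.dilateMap ≤ ha.starMap.comp ha.lowestStratum := fun U =>
  let ⟨_, _, _, h, _⟩ := isBasicAt_iff.1 (ha.isBasicAt_dilateSet U)
  h

variable {F : Bisheaf.{u, w} M}

/-- `a^* F` is pulled back from the strata of `A`. -/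
noncomputable def etalePullbackIsomorphism (ha : IsSimplicialEtale T a L ψ)
    (hF : F.IsConstructible T) :
    BisheafOn.Isomorphism ((F.onBasic T).etalePullback a ha.isLocalHomeomorph Set.univ)
      ((F.onConn.pullback ha.starMap).pullback ha.stratum) :=
  hF.isomorphism ha.imageMap_le fun U => ⟨_, ha.isBasicAt_image U, ha.isBasicAt_star _⟩

/-- `ȧ^* Σ^* F` is pulled back from the strata of `A`. -/
noncomputable def dilateEtalePullbackIsomorphism (ha : IsSimplicialEtale T a L ψ)
    (hF : F.IsConstructible T) :
    BisheafOn.Isomorphism ((F.dilate T).etalePullback a ha.isLocalHomeomorph L.shrinking)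
      ((F.onConn.pullback ha.starMap).pullback ha.lowestStratum) :=
  hF.isomorphism ha.dilateMap_le fun U => ⟨_, ha.isBasicAt_dilateSet U, ha.isBasicAt_star _⟩

end PullBack

end IsSimplicialEtale

theorem IsConstructibleEtale.isSimplicialEtale {m : ℕ} {M : Type u} [TopologicalSpace M]
    {A : Type u'} [TopologicalSpace A] {V : Type v} {W : Type v'} {T : Triangulation M V}
    {a : A → M} {L : Triangulation A W} {ψ : W → V} (ha : IsConstructibleEtale m T a L ψ) :
    IsSimplicialEtale T a L ψ where
  isLocalHomeomorph := ha.isLocalHomeomorph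
  push_mem := ha.simplicial
  comm := ha.comm

end PersistentSheaf

theorem proposition8p4_general {M : Type u} [TopologicalSpace M] {V : Type v}
    (T : PersistentSheaf.Triangulation M V)
    (F : PersistentSheaf.Bisheaf.{u, w} M) (hF : F.IsConstructible T)
    {A : Type u'} [TopologicalSpace A] {W : Type v'} (a : A → M)
    (L : PersistentSheaf.Triangulation A W) (ψ : W → V)
    (ha : PersistentSheaf.IsSimplicialEtale T a L ψ) :
    Nonempty
      ((((((F.onBasic T).etalePullback a ha.isLocalHomeomorph Set.univ).iso).pullback
          (PersistentSheaf.shrinkingMap T a ha.isLocalHomeomorph L)).image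
            ((PersistentSheaf.BisheafOn.isIsobisheaf_iso _).pullback _)).functor ≅
        (((((F.dilate T).etalePullback a ha.isLocalHomeomorph L.shrinking).iso).image
            (PersistentSheaf.BisheafOn.isIsobisheaf_iso _)).functor)) := by
  let G := F.onConn.pullback ha.starMap
  have hG := PersistentSheaf.BisheafOn.isIsobisheaf_iso G
  let μ := PersistentSheaf.shrinkingMap T a ha.isLocalHomeomorph L
  let e₁ := (ha.etalePullbackIsomorphism hF).iso.trans <|
    .isoPullback ha.isConnectedQuotient_stratum G
  let e₂ := (ha.dilateEtalePullbackIsomorphism hF).iso.trans <|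
    .isoPullback ha.isConnectedQuotient_lowestStratum G
  let compare := (G.iso.image hG).isoOfLE (p := ha.stratum.comp μ) ha.stratum_le_lowestStratum
  exact ⟨(e₁.pullback μ).image _ ((hG.pullback _).pullback _) ≪≫ compare ≪≫
    (e₂.image _ (hG.pullback _)).symm⟩

/-- The persistent local system of `Iso(a^* F)`, restricted to the shrinking of the étale open `a`,
is isomorphic to the persistent local system of `Iso(ȧ^* Σ^* F)`, where `ȧ` is the shrinking. -/
theorem proposition8p4 {m : ℕ} {M : Type u} [TopologicalSpace M] [T2Space M]
    [ChartedSpace (EuclideanSpace ℝ (Fin m)) M] {V : Type v}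
    (T : PersistentSheaf.Triangulation M V)
    (F : PersistentSheaf.Bisheaf.{u, w} M) (hF : F.IsConstructible T)
    {A : Type u'} [TopologicalSpace A] [T2Space A] {W : Type v'} (a : A → M)
    (L : PersistentSheaf.Triangulation A W) (ψ : W → V)
    (ha : PersistentSheaf.IsConstructibleEtale m T a L ψ) :
    Nonempty
      ((((((F.onBasic T).etalePullback a ha.isLocalHomeomorph Set.univ).iso).pullback
          (PersistentSheaf.shrinkingMap T a ha.isLocalHomeomorph L)).image
            ((PersistentSheaf.BisheafOn.isIsobisheaf_iso _).pullback _)).functor ≅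
        (((((F.dilate T).etalePullback a ha.isLocalHomeomorph L.shrinking).iso).image
            (PersistentSheaf.BisheafOn.isIsobisheaf_iso _)).functor)) := by
  exact proposition8p4_general T F hF a L ψ ha.isSimplicialEtale
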